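/- **Theorem (Non-Abelian extension of the dPIV).** Let $\gamma$ be a smooth regular ($C^1$, non-vanishing tangent) arc in $\mathbb{C}$ from $0$ to $1$ meeting each circle $|z|=R$ at most once. Let $W$ be an $N\times N$ matrix of weights on $\gamma$ of Jacobi type: each entry is a finite sum of terms $\varphi(z)\,z^{a}(1-z)^{b}\log^{p}(z)\log^{q}(1-z)$ with $\varphi$ entire and non-vanishing on $\gamma$, $\operatorname{Re}a,\operatorname{Re}b>-1$, $p,q\in\{0,1,\dots\}$, the determinations being continuous along $\gamma$. Assume that $W$ is regular, i.e. its moments $W_n=\frac1{2\pi i}\int_\gamma z^nW(z)\,dz$ satisfy $\det[W_{j+k}]_{j,k=0}^n\ne0$ for all $n\ge 0$, and that on $\gamma\setminus\{0,1\}$ $$z(1-z)W'(z)=(h_0+h_1z+h_2z^2)\,W(z)$$ with constant matrices $h_0,h_1,h_2\in\mathbb{C}^{N\times N}$. Then there are unique monic matrix polynomials $P_n$ of degree $n$ and nonsingular matrices $C_n$ with $\frac1{2\pi i}\int_\gamma P_n(z)W(z)z^k\,dz=\delta_{n,k}C_n^{-1}$ for $0\le k\le n$, $n\ge0$. Put $\gamma_n=C_n^{-1}C_{n-1}$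 for $n\ge1$ and $\gamma_0=0$. There are unique matrices $\beta_n$ with $zP_n=P_{n+1}+\beta_nP_n+\gamma_nP_{n-1}$ for all $n\ge0$ (with $P_{-1}=0$). Put $\beta_n^{\mathsf R}=C_n\beta_nC_n^{-1}$ and $[A,B]=AB-BA$. Then for all $n\ge0$ $$(2n+1)I+h_0+h_2(\gamma_{n+1}+\gamma_n)+\big(h_2\beta_n+h_1-(2n+1)I\big)\beta_n-\sum_{k=0}^{n-1}\beta_k-C_n^{-1}\Big(\sum_{k=0}^{n}\beta_k^{\mathsf R}\Big)C_n$$ $$=\Big[\sum_{k=0}^{n-1}\beta_k,h_2\Big]\sum_{k=0}^{n}\beta_k-\Big[\sum_{0\le j<i\le n-1}\beta_i\beta_j-\sum_{k=0}^{n-1}\gamma_k,\,h_2\Big]+\Big[\sum_{k=0}^{n-1}\beta_k,h_1\Big],$$ $$\beta_n-\beta_n^2-\gamma_n\big(h_2(\beta_n+\beta_{n-1})+h_1-(2n-1)I\big)+\big(h_2(\beta_n+\beta_{n+1})+h_1-(2n+3)I\big)\gamma_{n+1}$$ $$=-\gamma_n\Big[\sum_{k=0}^{n-2}\beta_k,h_2\Big]+\Big[\sum_{k=0}^{n-1}\beta_k,h_2\Big]\gamma_{n+1}-C_n^{-1}\Big[\sum_{k=0}^{n-1}\beta_k^{\mathsf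 R},\sum_{k=0}^{n}\beta_k^{\mathsf R}\Big]C_n$$ (terms multiplied by $\gamma_0=0$ are zero). Suppose moreover that $h_0,h_1,h_2$ commute with each other. Then all the matrices $h_0,h_1,h_2,\beta_n,\gamma_n$ ($n\ge 0$) commute with each other, and for all $n\ge0$ the system reduces to $$(2n+1)I+h_0+h_2(\gamma_{n+1}+\gamma_n)+\big(h_2\beta_n+h_1-(2n+1)I\big)\beta_n-\sum_{k=0}^{n-1}\beta_k-\sum_{k=0}^{n}\beta_k=0,$$ $$\beta_n-\beta_n^2-\gamma_n\big(h_2(\beta_n+\beta_{n-1})+h_1-(2n-1)I\big)+\big(h_2(\beta_n+\beta_{n+1})+h_1-(2n+3)I\big)\gamma_{n+1}=0.$$ In terms of $\xi_n=\frac{h_0}2+nI+h_2\gamma_n-\sum_{k=0}^{n-1}\beta_k$ and $\mu_n=h_2\beta_n+h_1-(2n+1)I$ these read $-\mu_n\beta_n=\xi_n+\xi_{n+1}$ and $\beta_n(\xi_n-\xi_{n+1})=\mu_{n+1}\gamma_{n+1}-\gamma_n\mu_{n-1}$, and the discrete Painlevé IV equation $$\xi_{n+1}^2-\xi_0^2=\gamma_{n+1}\mu_n\mu_{n+1},\qquad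 \beta_n\mu_n=-(\xi_n+\xi_{n+1})$$ holds. If in addition $h_2,\mu_n,\mu_{n+1}$ are invertible and $\nu_k=\mu_k^{-1}$, then $\xi_{n+1}^2-\xi_0^2$ is invertible and the equation takes the Boelen–Van Assche form $$\nu_n\nu_{n+1}=h_2^{-1}\Big(\xi_{n+1}-\tfrac{h_0}2-(n+1)I+\sum_{k=0}^{n}\beta_k\Big)\big(\xi_{n+1}^2-\xi_0^2\big)^{-1},$$ $$\xi_n+\xi_{n+1}=\big(h_2^{-1}h_1-h_2^{-1}\nu_n^{-1}-(2n+1)h_2^{-1}\big)\nu_n^{-1}.$$ -/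

import Mathlib

open Polynomial

noncomputable section

/-- Square complex matrices of size `N`. -/
abbrev Mat (N : ℕ) := Matrix (Fin N) (Fin N) ℂ

/-- `γ`, restricted to `[0, 1]`, is a smooth regular arc from `0` to `1` that meets no circle
`|z| = R` more than once (in particular it does not intersect itself). -/
structure IsSupportCurve (γ : ℝ → ℂ) : Prop where
  smooth : ContDiffOn ℝ 1 γ (Set.Icc 0 1)
  regular : ∀ t ∈ Set.Icc (0 : ℝ) 1, derivWithin γ (Set.Icc 0 1) t ≠ 0
  source : γ 0 = 0
  target : γ 1 = 1
  circle : Set.InjOn (fun t => ‖γ t‖) (Set.Icc 0 1)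

/-- The arc without its end points. -/
def openArc (γ : ℝ → ℂ) : Set ℂ := γ '' Set.Ioo 0 1

/-- `W` is of Jacobi type on the arc `γ`: every entry is a finite sum of terms
`φ(z) z ^ a (1 - z) ^ b (log z) ^ p (log (1 - z)) ^ q` with `φ` entire and non-vanishing on `γ`,
`Re a, Re b > -1` and `p, q ∈ ℕ`.  The continuous determinations of `log z` and of `log (1 - z)`
along `γ` are `l₀` and `l₁`. -/
def IsJacobiType {N : ℕ} (γ : ℝ → ℂ) (W : ℂ → Mat N) : Prop :=
  ∃ l₀ l₁ : ℝ → ℂ,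
    ContinuousOn l₀ (Set.Ioo 0 1) ∧ ContinuousOn l₁ (Set.Ioo 0 1) ∧
    (∀ t ∈ Set.Ioo (0 : ℝ) 1, Complex.exp (l₀ t) = γ t ∧ Complex.exp (l₁ t) = 1 - γ t) ∧
    ∀ j k : Fin N, ∃ (m : ℕ) (φ : Fin m → ℂ → ℂ) (a b : Fin m → ℂ) (p q : Fin m → ℕ),
      (∀ i, Differentiable ℂ (φ i) ∧ (∀ t ∈ Set.Icc (0 : ℝ) 1, φ i (γ t) ≠ 0) ∧
        -1 < (a i).re ∧ -1 < (b i).re) ∧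
      ∀ t ∈ Set.Ioo (0 : ℝ) 1,
        W (γ t) j k = ∑ i, φ i (γ t) * Complex.exp (a i * l₀ t) * Complex.exp (b i * l₁ t) *
          l₀ t ^ p i * l₁ t ^ q i

/-- `(2πi)⁻¹ ∫_γ F(z) dz`, entry by entry. -/
def contourInt {N : ℕ} (γ : ℝ → ℂ) (F : ℂ → Mat N) : Mat N :=
  Matrix.of fun i j =>
    (2 * (Real.pi : ℂ) * Complex.I)⁻¹ * ∫ t in (0 : ℝ)..1, F (γ t) i j * deriv γ t

/-- The moments `W_n = (2πi)⁻¹ ∫_γ z ^ n W(z) dz`. -/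
def moment {N : ℕ} (γ : ℝ → ℂ) (W : ℂ → Mat N) (n : ℕ) : Mat N :=
  contourInt γ fun z => z ^ n • W z

/-- `W` is regular: all block Hankel matrices `[W_{j+k}]_{j,k=0,…,n}` are nonsingular. -/
def IsRegularWeight {N : ℕ} (γ : ℝ → ℂ) (W : ℂ → Mat N) : Prop :=
  ∀ n : ℕ, (Matrix.of fun p q : Fin (n + 1) × Fin N =>
    moment γ W ((p.1 : ℕ) + (q.1 : ℕ)) p.2 q.2).det ≠ 0

/-- The Pearson equation `z (1 - z) W' = (h₀ + h₁ z + h₂ z ^ 2) W`, with the derivative taken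
along the open arc. -/
def SatisfiesPearson {N : ℕ} (γ : ℝ → ℂ) (W : ℂ → Mat N) (h₀ h₁ h₂ : Mat N) : Prop :=
  ∀ z ∈ openArc γ, ∃ W' : Mat N,
    (∀ i j, HasDerivWithinAt (fun w => W w i j) (W' i j) (openArc γ) z) ∧
    (z * (1 - z)) • W' = (h₀ + z • h₁ + z ^ 2 • h₂) * W z

/-- `P n` is the `n`-th monic left orthogonal matrix polynomial of `W`, with coefficients on the
left of the powers of the variable, and `C n` is the inverse of its norm:
`(2πi)⁻¹ ∫_γ P_n(z) W(z) z ^ k dz = δ_{n,k} C_n⁻¹` for `k = 0, …, n`.  (Monic of degree `n` is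
written through coefficients so that it also makes sense for `0 × 0` matrices.) -/
def IsLeftOrthogonal {N : ℕ} (γ : ℝ → ℂ) (W : ℂ → Mat N)
    (P : ℕ → (Mat N)[X]) (C : ℕ → Mat N) : Prop :=
  ∀ n : ℕ, (P n).natDegree ≤ n ∧ (P n).coeff n = 1 ∧ IsUnit (C n) ∧
    ∀ k ≤ n, contourInt γ (fun z => z ^ k • ((P n).eval (Matrix.scalar (Fin N) z) * W z)) =
      if k = n then (C n)⁻¹ else 0

/-- `γ_n = C_n⁻¹ C_{n-1}` for `n ≥ 1`, and `γ_0 = 0`. -/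
def gammaL {N : ℕ} (C : ℕ → Mat N) : ℕ → Mat N
  | 0 => 0
  | n + 1 => (C (n + 1))⁻¹ * C n

/-- `β^R_n = C_n β^L_n C_n⁻¹`. -/
def betaR {N : ℕ} (C β : ℕ → Mat N) (n : ℕ) : Mat N := C n * β n * (C n)⁻¹

/-- The three term recurrence `z P_n = P_{n+1} + β_n P_n + γ_n P_{n-1}`, `P_{-1} = 0`.
(For `n = 0` the last term is zero since `γ_0 = 0`.) -/
def ThreeTerm {N : ℕ} (P : ℕ → (Mat N)[X]) (C β : ℕ → Mat N) : Prop :=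
  ∀ n : ℕ, X * P n =
    P (n + 1) + Polynomial.C (β n) * P n + Polynomial.C (gammaL C n) * P (n - 1)

/-- `∑_{k=0}^{n-1} β_k`, i.e. minus the subleading coefficient of `P_n`. -/
def betaSum {N : ℕ} (β : ℕ → Mat N) (n : ℕ) : Mat N := ∑ k ∈ Finset.range n, β k

/-- `∑_{0 ≤ j < i ≤ n-1} β_i β_j - ∑_{k=0}^{n-1} γ_k`, i.e. the coefficient of `z ^ (n-2)`
in `P_n`. -/
def pairSum {N : ℕ} (C β : ℕ → Mat N) (n : ℕ) : Mat N :=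
  ∑ i ∈ Finset.range n, ∑ j ∈ Finset.range i, β i * β j - ∑ k ∈ Finset.range n, gammaL C k

/-- First equation of the non-Abelian system, at index `n`. -/
def NonAbelianEq1 {N : ℕ} (h₀ h₁ h₂ : Mat N) (C β : ℕ → Mat N) (n : ℕ) : Prop :=
  (2 * (n : ℂ) + 1) • (1 : Mat N) + h₀ + h₂ * (gammaL C (n + 1) + gammaL C n)
      + (h₂ * β n + h₁ - (2 * (n : ℂ) + 1) • (1 : Mat N)) * β n
      - betaSum β n - (C n)⁻¹ * betaSum (betaR C β) (n + 1) * C n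
    = ⁅betaSum β n, h₂⁆ * betaSum β (n + 1) - ⁅pairSum C β n, h₂⁆ + ⁅betaSum β n, h₁⁆

/-- Second equation of the non-Abelian system, at index `n`.  (For `n = 0` the terms that carry
the index `n - 1` are multiplied by `γ_0 = 0`.) -/
def NonAbelianEq2 {N : ℕ} (h₁ h₂ : Mat N) (C β : ℕ → Mat N) (n : ℕ) : Prop :=
  β n - β n ^ 2
      - gammaL C n * (h₂ * (β n + β (n - 1)) + h₁ - (2 * (n : ℂ) - 1) • (1 : Mat N))
      + (h₂ * (β n + β (n + 1)) + h₁ - (2 * (n : ℂ) + 3) • (1 : Mat N)) * gammaL C (n + 1)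
    = -(gammaL C n * ⁅betaSum β (n - 1), h₂⁆) + ⁅betaSum β n, h₂⁆ * gammaL C (n + 1)
      - (C n)⁻¹ * ⁅betaSum (betaR C β) n, betaSum (betaR C β) (n + 1)⁆ * C n

/-- `ξ_n = h₀ / 2 + n I + h₂ γ_n - ∑_{k=0}^{n-1} β_k`. -/
def xi {N : ℕ} (h₀ h₂ : Mat N) (C β : ℕ → Mat N) (n : ℕ) : Mat N :=
  (1 / 2 : ℂ) • h₀ + (n : ℂ) • (1 : Mat N) + h₂ * gammaL C n - betaSum β n

/-- `μ_n = h₂ β_n + h₁ - (2n + 1) I`. -/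
def mu {N : ℕ} (h₁ h₂ : Mat N) (β : ℕ → Mat N) (n : ℕ) : Mat N :=
  h₂ * β n + h₁ - (2 * (n : ℂ) + 1) • (1 : Mat N)

/-- All of `h₀, h₁, h₂, β_n, γ_n` commute with each other. -/
def AllCommute {N : ℕ} (h₀ h₁ h₂ : Mat N) (C β : ℕ → Mat N) : Prop :=
  (({h₀, h₁, h₂} : Set (Mat N)) ∪ Set.range β ∪ Set.range (gammaL C)).Pairwise Commute

/-- The local system to which the non-Abelian one reduces, at index `n`, first in the recurrence
coefficients and then in the variables `ξ_n`, `μ_n`. -/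
def AbelianSystem {N : ℕ} (h₀ h₁ h₂ : Mat N) (C β : ℕ → Mat N) (n : ℕ) : Prop :=
  ((2 * (n : ℂ) + 1) • (1 : Mat N) + h₀ + h₂ * (gammaL C (n + 1) + gammaL C n)
      + (h₂ * β n + h₁ - (2 * (n : ℂ) + 1) • (1 : Mat N)) * β n
      - betaSum β n - betaSum β (n + 1) = 0) ∧
  (β n - β n ^ 2
      - gammaL C n * (h₂ * (β n + β (n - 1)) + h₁ - (2 * (n : ℂ) - 1) • (1 : Mat N))
      + (h₂ * (β n + β (n + 1)) + h₁ - (2 * (n : ℂ) + 3) • (1 : Mat N)) * gammaL C (n + 1)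
    = 0) ∧
  -(mu h₁ h₂ β n * β n) = xi h₀ h₂ C β n + xi h₀ h₂ C β (n + 1) ∧
  β n * (xi h₀ h₂ C β n - xi h₀ h₂ C β (n + 1))
    = mu h₁ h₂ β (n + 1) * gammaL C (n + 1) - gammaL C n * mu h₁ h₂ β (n - 1)

/-- The discrete Painlevé IV equation at index `n`, in the variables `ξ_n`, `μ_n`. -/
def DiscretePIV {N : ℕ} (h₀ h₁ h₂ : Mat N) (C β : ℕ → Mat N) (n : ℕ) : Prop :=
  xi h₀ h₂ C β (n + 1) ^ 2 - xi h₀ h₂ C β 0 ^ 2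
    = gammaL C (n + 1) * mu h₁ h₂ β n * mu h₁ h₂ β (n + 1) ∧
  β n * mu h₁ h₂ β n = -(xi h₀ h₂ C β n + xi h₀ h₂ C β (n + 1))

/-- The discrete Painlevé IV equation at index `n`, in the variables `ξ_n`, `ν_n = μ_n⁻¹`. -/
def DiscretePIVInv {N : ℕ} (h₀ h₁ h₂ : Mat N) (C β : ℕ → Mat N) (n : ℕ) : Prop :=
  IsUnit (xi h₀ h₂ C β (n + 1) ^ 2 - xi h₀ h₂ C β 0 ^ 2) ∧
  (mu h₁ h₂ β n)⁻¹ * (mu h₁ h₂ β (n + 1))⁻¹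
    = h₂⁻¹ * (xi h₀ h₂ C β (n + 1) - (1 / 2 : ℂ) • h₀ - ((n : ℂ) + 1) • (1 : Mat N)
        + betaSum β (n + 1)) * (xi h₀ h₂ C β (n + 1) ^ 2 - xi h₀ h₂ C β 0 ^ 2)⁻¹ ∧
  xi h₀ h₂ C β n + xi h₀ h₂ C β (n + 1)
    = (h₂⁻¹ * h₁ - h₂⁻¹ * ((mu h₁ h₂ β n)⁻¹)⁻¹ - (2 * (n : ℂ) + 1) • h₂⁻¹)
        * ((mu h₁ h₂ β n)⁻¹)⁻¹

end

/-!
Write `⟨p, k⟩ = (2πi)⁻¹ ∫_γ p(z) W(z) z ^ k dz` for the pairing of a polynomial `p` with left matrix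
coefficients and a power of the variable.  It depends on the moments of `W` only, and everything
except the vanishing of boundary terms and the commutation property is algebra over the ring of
matrices.

*Analysis.*  Near an end point a continuous logarithm of a function vanishing to first order is
`log t` plus a convergent term (`tendsto_sub_log`), so the entries of a Jacobi type weight are
bounded there by an integrable power of the parameter (`IsJacobiType.bounds`).  Hence the moments
exist, and integrating the Pearson equation by parts, without boundary terms, gives a recurrence for
them (`moment_recurrence`).

*Algebra.*  Nonsingular block Hankel matrices provide the monic orthogonal polynomials
(`exists_monic_orthogonal`).  By the moment recurrence, the operator
`D p = z (1 - z) p' + p (h₀ + h₁ z + h₂ z ^ 2)` is adjoint to the map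
`z ^ k ↦ -(z (1 - z) z ^ k)'` (`momentPairing_pearsonOp`), so `D P_n` is a combination of
`P_{n+2}, …, P_{n-1}` only (`IsOrthogonalSystem.structure_relation`).  The upper two coefficients of
this combination come from the leading coefficients of the polynomials and the lower two from
pairings, which is how the conjugated sums of the `β^R_k` enter.  Comparing the coefficients of
`z ^ n` in this relation gives the first equation; the second one is the coefficient of `P_n` in
the compatibility condition `D (z p) = z (1 - z) p + z D p` with the three term recurrence.

*Commutation.*  Suppose that `x` commutes with `h₀, h₁, h₂`.  Then `x W` and `W (M⁻¹ x M)`, with `M`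
the value of `W` at a point of the arc, satisfy the same linear differential equation and agree at
that point.  Therefore `x W = W y` for the constant `y = M⁻¹ x M`, and the same relation holds for
all moments (`exists_intertwiner`).  By uniqueness of the orthogonal polynomials `x` commutes with
their coefficients, with all `β_n` and `γ_n`, and its conjugates by the `C_n` coincide.  If the
`h_i` commute with each other, this applies to `x = h_i` first and then to `x = β_n` and
`x = γ_n`.  In the commutative algebra so obtained, the product of the two reduced equations
telescopes to the discrete Painlevé IV equation.
-/

noncomputable section

/-! ### Pairing of polynomials with powers against a moment sequence -/

section MomentPairing

variable {R : Type*} [Ring R]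

/-- The pairing of a polynomial with `z ^ k`: the left `R`-linear functional
`∑ aⱼ z ^ j ↦ ∑ aⱼ m_{j+k}` on polynomials determined by the moment sequence `m`. -/
def momentPairing (m : ℕ → R) (k : ℕ) : R[X] →ₗ[R] R :=
  Polynomial.lsum fun j => LinearMap.toSpanSingleton R R (m (j + k))

variable (m : ℕ → R)

theorem momentPairing_monomial (k j : ℕ) (a : R) :
    momentPairing m k (monomial j a) = a * m (j + k) := by
  simp [momentPairing, Polynomial.lsum_apply]

theorem momentPairing_X_mul (k : ℕ) (p : R[X]) :
    momentPairing m k (X * p) = momentPairing m (k + 1) p := by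
  induction p using Polynomial.induction_on' with
  | add p q hp hq => simp [mul_add, hp, hq]
  | monomial j a =>
    rw [X_mul_monomial, momentPairing_monomial, momentPairing_monomial]
    congr 2; omega

/-- Multiplication by the central variable, as a left `R`-linear map. -/
def mulX : R[X] →ₗ[R] R[X] where
  toFun p := X * p
  map_add' := mul_add X
  map_smul' a p := by
    simp only [smul_eq_C_mul, RingHom.id_apply, ← mul_assoc, X_mul_C]

theorem mulX_apply (p : R[X]) : mulX p = X * p := rfl

/-- The differential operator `p ↦ z (1 - z) p' + p (h₀ + h₁ z + h₂ z ^ 2)` attached to a weight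
with Pearson equation `z (1 - z) W' = (h₀ + h₁ z + h₂ z ^ 2) W`; it satisfies
`z (1 - z) (p W)' = (pearsonOp p) W`. -/
def pearsonOp (h₀ h₁ h₂ : R) : R[X] →ₗ[R] R[X] where
  toFun p := X * derivative p - X * (X * derivative p)
    + (p * C h₀ + X * (p * C h₁) + X * (X * (p * C h₂)))
  map_add' p q := by simp only [map_add, mul_add, add_mul]; abel
  map_smul' a p := by
    have h (q : R[X]) : X * (C a * q) = C a * (X * q) := by
      rw [← mul_assoc, X_mul_C, mul_assoc]
    simp only [smul_eq_C_mul, derivative_C_mul, RingHom.id_apply, mul_assoc, h]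
    simp only [mul_add, mul_sub]

variable (h₀ h₁ h₂ : R)

theorem pearsonOp_apply (p : R[X]) : pearsonOp h₀ h₁ h₂ p =
    X * derivative p - X * (X * derivative p)
      + (p * C h₀ + X * (p * C h₁) + X * (X * (p * C h₂))) := rfl

theorem pearsonOp_mulX (p : R[X]) : pearsonOp h₀ h₁ h₂ (mulX p) =
    mulX p - mulX (mulX p) + mulX (pearsonOp h₀ h₁ h₂ p) := by
  simp only [pearsonOp_apply, mulX_apply, derivative_mul, derivative_X]
  noncomm_ring

/-- Coefficients of `pearsonOp p`.  Those of `p` with a lower index are written through `X * p`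
and `X * (X * p)`, so that no index is subtracted. -/
theorem coeff_pearsonOp (p : R[X]) (i : ℕ) : (pearsonOp h₀ h₁ h₂ p).coeff i =
    i * p.coeff i - ((i : R) - 1) * (X * p).coeff i
      + (p.coeff i * h₀ + (X * p).coeff i * h₁ + (X * (X * p)).coeff i * h₂) := by
  have hX (q : R[X]) (b : R) : X * (q * C b) = X * q * C b := (mul_assoc _ _ _).symm
  have h1 (j : ℕ) : (X * derivative p).coeff j = j * p.coeff j := by
    cases j with
    | zero => simp
    | succ j =>
      rw [coeff_X_mul, coeff_derivative, ← Nat.cast_succ, (Nat.cast_commute _ _).eq]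
  have h2 : (X * (X * derivative p)).coeff i = ((i : R) - 1) * (X * p).coeff i := by
    cases i with
    | zero => simp
    | succ j => rw [coeff_X_mul, coeff_X_mul, h1]; simp
  simp only [pearsonOp_apply, coeff_add, coeff_sub, h1, h2, hX, coeff_mul_C]

theorem coeff_mulX_succ (p : R[X]) (i : ℕ) : (mulX p).coeff (i + 1) = p.coeff i :=
  coeff_X_mul p i

/-- Integration by parts: if the moments satisfy the recurrence expressing that
`z (1 - z) W' = (h₀ + h₁ z + h₂ z ^ 2) W`, then pairing `pearsonOp p` with `z ^ k` amounts to
pairing `p` with `-(z (1 - z) z ^ k)'`. -/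
theorem momentPairing_pearsonOp
    (hm : ∀ j : ℕ, ((j : R) + 1) * m j - ((j : R) + 2) * m (j + 1)
      + (h₀ * m j + h₁ * m (j + 1) + h₂ * m (j + 2)) = 0)
    (k : ℕ) (p : R[X]) : momentPairing m k (pearsonOp h₀ h₁ h₂ p) =
      ((k : R) + 2) * momentPairing m (k + 1) p - ((k : R) + 1) * momentPairing m k p := by
  induction p using Polynomial.induction_on' with
  | add p q hp hq => simp only [map_add, hp, hq]; noncomm_ring
  | monomial j a =>
    have hd (l : ℕ) : momentPairing m l (X * derivative (monomial j a)) = j * (a * m (j + l)) := by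
      cases j with
      | zero => simp
      | succ j =>
        rw [derivative_monomial, X_mul_monomial, momentPairing_monomial]
        simp only [Nat.add_sub_cancel]
        rw [← (Nat.cast_commute _ a).eq, mul_assoc]
    rw [pearsonOp_apply]
    simp only [map_add, map_sub, momentPairing_X_mul, hd, monomial_mul_C,
      momentPairing_monomial]
    have e := congrArg (a * ·) (hm (j + k))
    have hc (x : ℕ) (y : R) : a * (x * y) = x * (a * y) := by
      rw [← mul_assoc, ← (Nat.cast_commute x a).eq, mul_assoc]
    simp only [mul_zero, mul_add, add_mul, mul_sub, hc, Nat.cast_add, one_mul, two_mul,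
      add_assoc] at e ⊢
    rw [← sub_eq_zero, ← e]
    simp only [show 1 + 1 = 2 from rfl, mul_assoc]
    abel

end MomentPairing

/-! ### Structure relation and the non-Abelian system -/

section OrthogonalSystem

variable {R : Type*} [Ring R]

/-- `P n` are the monic left orthogonal polynomials of the moment sequence `m`, `E n` their
norms and `C n` the inverses of these; `g n = E n * C (n - 1)` with the convention `g 0 = 0`. -/
structure IsOrthogonalSystem (m : ℕ → R) (P : ℕ → R[X]) (C E g : ℕ → R) : Prop where
  coeff_gt : ∀ n i, n < i → (P n).coeff i = 0
  coeff_self : ∀ n, (P n).coeff n = 1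
  mul_norm : ∀ n, C n * E n = 1
  norm_mul : ∀ n, E n * C n = 1
  pairing_lt : ∀ n k, k < n → momentPairing m k (P n) = 0
  pairing_self : ∀ n, momentPairing m n (P n) = E n
  gamma_zero : g 0 = 0
  gamma_succ : ∀ n, g (n + 1) = E (n + 1) * C n

variable {m : ℕ → R} {P : ℕ → R[X]} {C E g : ℕ → R}

namespace IsOrthogonalSystem

variable (h : IsOrthogonalSystem m P C E g)

include h

/-- Nondegeneracy: a polynomial of degree less than `n` that is orthogonal to `z ^ k` for all
`k < n` is zero. -/
theorem eq_zero (n : ℕ) (q : R[X]) (hq : ∀ i, n ≤ i → q.coeff i = 0)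
    (hp : ∀ k < n, momentPairing m k q = 0) : q = 0 := by
  induction n generalizing q with
  | zero => ext i; simpa using hq i (Nat.zero_le _)
  | succ n ih =>
    have key : q = q.coeff n • P n := by
      rw [← sub_eq_zero]
      refine ih _ (fun i hi => ?_) fun k hk => ?_
      · rcases hi.eq_or_lt with rfl | hi
        · simp [h.coeff_self]
        · simp [h.coeff_gt n i hi, hq i hi]
      · simp [hp k (by omega), h.pairing_lt n k hk]
    have h0 : q.coeff n * E n = 0 := by
      rw [← h.pairing_self n, ← smul_eq_mul, ← map_smul, ← key]
      exact hp n (Nat.lt_succ_self n)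
    have : q.coeff n = 0 := by
      rw [← mul_one (q.coeff n), ← h.norm_mul n, ← mul_assoc, h0, zero_mul]
    rw [key, this, zero_smul]

/-- Monic polynomials of increasing degrees are linearly independent: the coefficient of `P n` in
a vanishing combination with terms of degree up to `n + 3` is zero. -/
theorem coeff_eq_zero_of_combination (n : ℕ) (a₀ a₁ a₂ a₃ : R) (q : R[X])
    (hq : ∀ i, n ≤ i → q.coeff i = 0)
    (hc : a₃ • P (n + 3) + a₂ • P (n + 2) + a₁ • P (n + 1) + a₀ • P n + q = 0) : a₀ = 0 := by
  have e (i : ℕ) := congrArg (fun p => p.coeff i) hc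
  have e3 := e (n + 3)
  have e2 := e (n + 2)
  have e1 := e (n + 1)
  have e0 := e n
  simp [h.coeff_self, h.coeff_gt (n + 2) (n + 3), h.coeff_gt (n + 1) (n + 3),
    h.coeff_gt n (n + 3), hq] at e3
  simp [h.coeff_self, h.coeff_gt (n + 1) (n + 2), h.coeff_gt n (n + 2), hq, e3] at e2
  simp [h.coeff_self, h.coeff_gt n (n + 1), hq, e3, e2] at e1
  simpa [h.coeff_self, hq, e3, e2, e1] using e0

/-- The term `γ_n P_{n-1}` of the recurrence has degree less than `n`, for `n = 0` because
`γ_0 = 0` (in which case `P (n - 1)` is `P 0`). -/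
theorem gamma_smul_coeff (n i : ℕ) (hi : n ≤ i) : g n * (P (n - 1)).coeff i = 0 := by
  cases n with
  | zero => rw [h.gamma_zero, zero_mul]
  | succ n => rw [h.coeff_gt _ _ (by simpa using hi), mul_zero]

/-- The three term recurrence, with the difference of consecutive subleading coefficients as the
coefficient `β_n`: the defect has degree less than `n` and is orthogonal to the lower powers. -/
theorem three_term (n : ℕ) : mulX (P n) =
    P (n + 1) + ((mulX (P n)).coeff n - (P (n + 1)).coeff n) • P n + g n • P (n - 1) := by
  rw [← sub_eq_zero]
  refine h.eq_zero n _ (fun i hi => ?_) fun k hk => ?_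
  · simp only [coeff_sub, coeff_add, coeff_smul, smul_eq_mul, h.gamma_smul_coeff n i hi]
    rcases hi.eq_or_lt with rfl | hi
    · simp [h.coeff_self]
    · rw [h.coeff_gt n i hi]
      obtain ⟨j, rfl⟩ : ∃ j, i = j + 1 := ⟨i - 1, by omega⟩
      rw [coeff_mulX_succ]
      rcases (Nat.lt_succ_iff.1 hi).eq_or_lt with rfl | hj
      · simp [h.coeff_self]
      · simp [h.coeff_gt n j hj, h.coeff_gt (n + 1) (j + 1) (by omega)]
  · simp only [map_sub, map_add, map_smul, smul_eq_mul, h.pairing_lt (n + 1) k (by omega),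
      h.pairing_lt n k hk, mulX_apply, momentPairing_X_mul]
    obtain ⟨l, rfl⟩ : ∃ l, n = l + 1 := ⟨n - 1, by omega⟩
    rcases (Nat.lt_succ_iff.1 hk).eq_or_lt with rfl | hl
    · simp [h.pairing_self, h.gamma_succ, mul_assoc, h.mul_norm]
    · simp [h.pairing_lt (l + 1) (k + 1) (by omega), h.pairing_lt l k hl]

variable {β : ℕ → R} (hβ : ∀ n, mulX (P n) = P (n + 1) + β n • P n + g n • P (n - 1))

include hβ

theorem beta_eq (n : ℕ) : β n = (mulX (P n)).coeff n - (P (n + 1)).coeff n := by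
  rw [hβ n]
  simp [h.coeff_self, h.gamma_smul_coeff n n le_rfl]

/-- The coefficient of `z ^ (n - 1)` in `P n`. -/
theorem coeff_mulX (n : ℕ) : (mulX (P n)).coeff n = -∑ k ∈ Finset.range n, β k := by
  induction n with
  | zero => simp [mulX_apply]
  | succ n ih =>
    rw [Finset.sum_range_succ, neg_add, ← ih, h.beta_eq hβ n, coeff_mulX_succ]
    abel

/-- The coefficient of `z ^ (n - 2)` in `P n`. -/
theorem coeff_mulX_mulX (n : ℕ) : (mulX (mulX (P n))).coeff n =
    ∑ i ∈ Finset.range n, ∑ j ∈ Finset.range i, β i * β j - ∑ k ∈ Finset.range n, g k := by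
  induction n with
  | zero => simp [mulX_apply]
  | succ n ih =>
    rw [Finset.sum_range_succ, Finset.sum_range_succ]
    have e : P (n + 1) = mulX (P n) - β n • P n - g n • P (n - 1) := by rw [hβ n]; abel
    have hg : g n * (mulX (P (n - 1))).coeff n = g n := by
      cases n with
      | zero => simp [h.gamma_zero]
      | succ n => simp [coeff_mulX_succ, h.coeff_self]
    rw [coeff_mulX_succ, e]
    simp only [map_sub, map_smul, coeff_sub, coeff_smul, smul_eq_mul, ih, h.coeff_mulX hβ, hg,
      ← Finset.mul_sum]
    noncomm_ring

theorem pairing_succ_eq_add (n : ℕ) : momentPairing m (n + 1) (P n) =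
    β n * E n + g n * momentPairing m n (P (n - 1)) := by
  rw [← momentPairing_X_mul, ← mulX_apply, hβ n]
  simp [h.pairing_self, h.pairing_lt (n + 1) n]

/-- The first moment above the orthogonality range: `(2πi)⁻¹ ∫ P_n W z ^ (n + 1) dz` is
`C_n⁻¹` times minus the subleading coefficient of the right orthogonal polynomial of degree
`n + 1`. -/
theorem pairing_succ (n : ℕ) : momentPairing m (n + 1) (P n) =
    E n * ∑ k ∈ Finset.range (n + 1), C k * β k * E k := by
  have e := h.pairing_succ_eq_add hβ
  induction n with
  | zero => simp [e, h.gamma_zero, ← mul_assoc, h.norm_mul]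
  | succ n ih =>
    rw [e, Finset.sum_range_succ, h.gamma_succ, Nat.add_sub_cancel, ih, mul_add]
    simp only [← mul_assoc, h.norm_mul, one_mul]
    rw [mul_assoc (E (n + 1)), h.mul_norm, mul_one, add_comm]

variable {h₀ h₁ h₂ : R}
  (hm : ∀ j : ℕ, ((j : R) + 1) * m j - ((j : R) + 2) * m (j + 1)
      + (h₀ * m j + h₁ * m (j + 1) + h₂ * m (j + 2)) = 0)

include hm

/-- The structure relation: `pearsonOp` maps `P n` to a combination of `P (n + 2)`, …,
`P (n - 1)`.  The upper two coefficients are read off from the leading coefficients, the lower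
two from the pairing with `z ^ n` and `z ^ (n - 1)`. -/
theorem structure_relation (n : ℕ) : pearsonOp h₀ h₁ h₂ (P n) =
    h₂ • P (n + 2)
    + (h₁ - n - (∑ k ∈ Finset.range n, β k) * h₂ + h₂ * ∑ k ∈ Finset.range (n + 2), β k) • P (n + 1)
    + (-(n + 1 : R) + E n * (∑ k ∈ Finset.range (n + 1), C k * β k * E k) * C n
        + (n + 1 : R) * β n) • P n
    + ((n + 1 : R) * g n) • P (n - 1) := by
  rw [← sub_eq_zero]
  refine h.eq_zero (n + 1) _ (fun i hi => ?_) fun k hk => ?_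
  · have hg : (n + 1 : R) * g n * (P (n - 1)).coeff i = 0 := by
      rw [mul_assoc, h.gamma_smul_coeff n i (by omega), mul_zero]
    have h0 : (P n).coeff i = 0 := h.coeff_gt n i hi
    obtain ⟨j, rfl⟩ : ∃ j, i = j + 1 := ⟨i - 1, by omega⟩
    simp only [coeff_sub, coeff_add, coeff_smul, smul_eq_mul, coeff_pearsonOp, ← mulX_apply, hg,
      h0, coeff_mulX_succ]
    rcases (Nat.le_of_succ_le_succ hi).eq_or_lt with rfl | hj
    · simp only [h.coeff_self, h.coeff_mulX hβ,
        show (P (n + 2)).coeff (n + 1) = -∑ k ∈ Finset.range (n + 2), β k by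
          rw [← h.coeff_mulX hβ, coeff_mulX_succ]]
      push_cast
      noncomm_ring
    · obtain ⟨l, rfl⟩ : ∃ l, j = l + 1 := ⟨j - 1, by omega⟩
      rw [h.coeff_gt n _ hj, h.coeff_gt (n + 1) (l + 1 + 1) (by omega), coeff_mulX_succ]
      rcases (Nat.lt_succ_iff.1 hj).eq_or_lt with rfl | hl
      · simp [h.coeff_self]
      · simp [h.coeff_gt n l hl, h.coeff_gt (n + 2) (l + 1 + 1) (by omega)]
  · simp only [map_sub, map_add, map_smul, smul_eq_mul, momentPairing_pearsonOp m h₀ h₁ h₂ hm,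
      h.pairing_lt (n + 1) k hk, h.pairing_lt (n + 2) k (by omega), mul_zero, zero_add]
    rcases (Nat.lt_succ_iff.1 hk).eq_or_lt with rfl | hk
    · have e1 : g k * momentPairing m k (P (k - 1)) =
          momentPairing m (k + 1) (P k) - β k * E k := by
        rw [h.pairing_succ_eq_add hβ, add_sub_cancel_left]
      have e2 : E k * (∑ k ∈ Finset.range (k + 1), C k * β k * E k) * C k * E k =
          momentPairing m (k + 1) (P k) := by
        rw [mul_assoc _ (C k) (E k), h.mul_norm, mul_one, ← h.pairing_succ hβ]
      rw [h.pairing_self, mul_assoc (k + 1 : R) (g k), e1]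
      simp only [add_mul, e2]
      noncomm_ring
    · obtain ⟨l, rfl⟩ : ∃ l, n = l + 1 := ⟨n - 1, by omega⟩
      rcases (Nat.lt_succ_iff.1 hk).eq_or_lt with rfl | hl
      · simp only [h.pairing_self, h.pairing_lt (k + 1) k hk, h.gamma_succ, Nat.add_sub_cancel,
          mul_assoc, h.mul_norm, mul_one]
        push_cast
        noncomm_ring
      · simp [h.pairing_lt (l + 1) (k + 1) (by omega), h.pairing_lt l k hl, h.pairing_lt (l + 1) k hk]

/-- The first equation of the system: the coefficient of `z ^ n` in the structure relation. -/
theorem first_equation (n : ℕ) :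
    (2 * n + 1 : R) + h₀ + h₂ * (g (n + 1) + g n)
      + (h₂ * β n + h₁ - (2 * n + 1 : R)) * β n
      - (∑ k ∈ Finset.range n, β k) - E n * (∑ k ∈ Finset.range (n + 1), C k * β k * E k) * C n
    = ⁅∑ k ∈ Finset.range n, β k, h₂⁆ * (∑ k ∈ Finset.range (n + 1), β k)
      - ⁅∑ i ∈ Finset.range n, ∑ j ∈ Finset.range i, β i * β j - ∑ k ∈ Finset.range n, g k, h₂⁆
      + ⁅∑ k ∈ Finset.range n, β k, h₁⁆ := by
  have e := congrArg (fun p => p.coeff n) (h.structure_relation hβ hm n)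
  have hg : (n + 1 : R) * g n * (P (n - 1)).coeff n = 0 := by
    rw [mul_assoc, h.gamma_smul_coeff n n le_rfl, mul_zero]
  have c1 : (P (n + 1)).coeff n = -∑ k ∈ Finset.range (n + 1), β k := by
    rw [← h.coeff_mulX hβ, coeff_mulX_succ]
  have c2 : (P (n + 2)).coeff n = ∑ i ∈ Finset.range (n + 2), ∑ j ∈ Finset.range i, β i * β j
      - ∑ k ∈ Finset.range (n + 2), g k := by
    rw [← h.coeff_mulX_mulX hβ, coeff_mulX_succ, coeff_mulX_succ]
  simp only [coeff_add, coeff_smul, smul_eq_mul, coeff_pearsonOp, ← mulX_apply, hg, c1, c2,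
    h.coeff_self, h.coeff_mulX hβ, h.coeff_mulX_mulX hβ, Finset.sum_range_succ _ (n + 1),
    Finset.sum_range_succ β n, Finset.sum_range_succ g n, ← Finset.mul_sum,
    Finset.sum_range_succ (fun i => β i * ∑ j ∈ Finset.range i, β j) n] at e
  have e' := sub_eq_zero.2 e
  rw [← sub_eq_zero, ← e', Ring.lie_def, Ring.lie_def, Ring.lie_def]
  simp only [← Finset.mul_sum, Finset.sum_range_succ β n]
  generalize E n * (∑ k ∈ Finset.range (n + 1), C k * β k * E k) * C n = A
  noncomm_ring

/-- The second equation of the system: the coefficient of `P n` in the two expansions of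
`pearsonOp (z P_n)` that the recurrence and the structure relation provide. -/
theorem second_equation (n : ℕ) :
    β n - β n ^ 2
      - g n * (h₂ * (β n + β (n - 1)) + h₁ - (2 * n - 1 : R))
      + (h₂ * (β n + β (n + 1)) + h₁ - (2 * n + 3 : R)) * g (n + 1)
    = -(g n * ⁅∑ k ∈ Finset.range (n - 1), β k, h₂⁆)
      + ⁅∑ k ∈ Finset.range n, β k, h₂⁆ * g (n + 1)
      - E n * ⁅∑ k ∈ Finset.range n, C k * β k * E k,
          ∑ k ∈ Finset.range (n + 1), C k * β k * E k⁆ * C n := by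
  have hs := h.structure_relation hβ hm
  obtain ⟨b, hb⟩ : ∃ b : ℕ → R, ∀ n : ℕ, b n = h₁ - n - (∑ k ∈ Finset.range n, β k) * h₂
    + h₂ * ∑ k ∈ Finset.range (n + 2), β k := ⟨_, fun _ => rfl⟩
  obtain ⟨c, hc⟩ : ∃ c : ℕ → R, ∀ n : ℕ, c n = -(n + 1 : R)
    + E n * (∑ k ∈ Finset.range (n + 1), C k * β k * E k) * C n + (n + 1 : R) * β n :=
    ⟨_, fun _ => rfl⟩
  simp only [← hb, ← hc] at hs
  have hgX : g n • mulX (P (n - 1)) =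
      g n • P n + g n • β (n - 1) • P (n - 1) + g n • g (n - 1) • P (n - 1 - 1) := by
    cases n with
    | zero => simp [h.gamma_zero]
    | succ n => rw [Nat.add_sub_cancel, hβ n, smul_add, smul_add]
  have hgD : g n • pearsonOp h₀ h₁ h₂ (P (n - 1)) = g n • h₂ • P (n + 1) + g n • b (n - 1) • P n
      + g n • c (n - 1) • P (n - 1) + g n • (n : R) • g (n - 1) • P (n - 1 - 1) := by
    cases n with
    | zero => simp [h.gamma_zero]
    | succ n =>
      rw [Nat.add_sub_cancel, hs n]
      simp only [smul_add, mul_smul, Nat.cast_succ]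
  have key : β n - (g (n + 1) + β n ^ 2 + g n) + (b n * g (n + 1) + c n * β n + (n + 1) * g n)
      - ((n + 2) * g (n + 1) + β n * c n + g n * b (n - 1)) = 0 := by
    refine h.coeff_eq_zero_of_combination n _
      (1 - (β (n + 1) + β n) + (h₂ * g (n + 2) + b n * β (n + 1) + c n)
        - (c (n + 1) + β n * b n + g n * h₂))
      (-1 + (h₂ * β (n + 2) + b n) - (b (n + 1) + β n * h₂)) 0
      ((g n - (β n * g n + g n * β (n - 1)) + (c n * g n + (n + 1) * g n * β (n - 1))
          - (β n * ((n + 1) * g n) + g n * c (n - 1))) • P (n - 1)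
        + (-(g n * g (n - 1)) + (n + 1) * g n * g (n - 1) - g n * (n * g (n - 1)))
          • P (n - 1 - 1)) (fun i hi => ?_) ?_
    · cases n with
      | zero => simp [h.gamma_zero]
      | succ n =>
        simp [h.coeff_gt n i (by omega), h.coeff_gt (n - 1) i (by omega)]
    · have e := pearsonOp_mulX h₀ h₁ h₂ (P n)
      rw [← sub_eq_zero] at e
      rw [hβ n, hs n] at e
      simp only [map_add, map_smul, hgX, hgD, hs n, hs (n + 1), hβ n, hβ (n + 1), hβ (n + 2),
        Nat.add_sub_cancel, smul_add, mul_smul] at e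
      rw [← neg_eq_zero, neg_sub] at e
      rw [← e]
      simp only [add_smul, sub_smul, neg_smul, one_smul, mul_smul, pow_two, zero_smul, two_smul,
        smul_add, Nat.cast_succ, show n + 1 + 2 = n + 3 from rfl, show n + 1 + 1 = n + 2 from rfl,
        show n + 2 - 1 = n + 1 from rfl]
      abel
  -- scalars drop out of the commutator, and conjugation by `C n` turns `β n` into `β^R_n`
  have hcb : c n * β n - β n * c n = E n * ⁅∑ k ∈ Finset.range n, C k * β k * E k,
      ∑ k ∈ Finset.range (n + 1), C k * β k * E k⁆ * C n := by
    have hC : C n * β n = C n * β n * E n * C n := by rw [mul_assoc _ (E n), h.norm_mul, mul_one]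
    have hE : β n * E n = E n * (C n * β n * E n) := by
      simp only [← mul_assoc, h.norm_mul, one_mul]
    rw [hc n, Ring.lie_def, Finset.sum_range_succ]
    set B := ∑ k ∈ Finset.range n, C k * β k * E k
    set r := C n * β n * E n
    have e1 : E n * (B + r) * C n * β n = E n * (B + r) * (r * C n) := by rw [mul_assoc, hC]
    have e2 : β n * (E n * (B + r) * C n) = E n * r * (B + r) * C n := by
      simp only [← mul_assoc, hE]
    have e3 : β n * (n : R) = n * β n := ((Nat.cast_commute n (β n)).eq).symm
    have e4 : β n * ((n + 1 : R) * β n) = (n + 1 : R) * β n * β n := by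
      simp only [mul_add, add_mul, ← mul_assoc, e3, one_mul]
    rw [add_mul, add_mul, e1, mul_add (β n), mul_add (β n), e2, e4, mul_neg, neg_mul,
      mul_add (β n), e3]
    noncomm_ring
  rw [← sub_eq_zero, ← key, ← sub_eq_zero, Ring.lie_def, Ring.lie_def, ← hcb, hb n]
  cases n with
  | zero => 
    simp only [h.gamma_zero]
    simp [Finset.sum_range_succ]
    noncomm_ring
  | succ n =>
    rw [Nat.add_sub_cancel, hb n]
    simp only [Finset.sum_range_succ β, Nat.cast_succ, show n + 1 + 1 = n + 2 from rfl]
    have hn (x : R) : x * (n : R) = n * x := ((Nat.cast_commute n x).eq).symm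
    noncomm_ring
    simp only [hn]
    abel

end IsOrthogonalSystem

end OrthogonalSystem

/-! ### Commutation properties and existence of orthogonal polynomials -/

section Commutation

variable {R : Type*} [Ring R]

/-- If `x m_j = m_j y` for all `j`, right multiplication of a polynomial by `x` becomes right
multiplication of its pairings by `y`. -/
theorem momentPairing_mul_C (m : ℕ → R) {x y : R} (hxy : ∀ j, x * m j = m j * y) (k : ℕ)
    (p : R[X]) : momentPairing m k (p * C x) = momentPairing m k p * y := by
  induction p using Polynomial.induction_on' with
  | add p q hp hq => simp [add_mul, hp, hq]
  | monomial j a =>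
    rw [monomial_mul_C, momentPairing_monomial, momentPairing_monomial, mul_assoc, hxy, mul_assoc]

namespace IsOrthogonalSystem

variable {m : ℕ → R} {P : ℕ → R[X]} {C E g : ℕ → R} (h : IsOrthogonalSystem m P C E g)
  {x y : R} (hxy : ∀ j, x * m j = m j * y)

include h hxy

/-- If `x m_j = m_j y` for all `j`, then `x P_n - P_n x` has degree less than `n` and is still
orthogonal to the lower powers, so `x` commutes with the coefficients of `P n`. -/
theorem smul_eq_mul_C (n : ℕ) : x • P n = P n * Polynomial.C x := by
  rw [← sub_eq_zero]
  refine h.eq_zero n _ (fun i hi => ?_) fun k hk => ?_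
  · rcases hi.eq_or_lt with rfl | hi
    · simp [h.coeff_self]
    · simp [h.coeff_gt n i hi]
  · rw [map_sub, map_smul, momentPairing_mul_C m hxy, h.pairing_lt n k hk]
    simp

theorem commute_beta {β : ℕ → R}
    (hβ : ∀ n, mulX (P n) = P (n + 1) + β n • P n + g n • P (n - 1)) (n : ℕ) :
    Commute x (β n) := by
  have hc (n i : ℕ) : Commute x ((P n).coeff i) := by
    rw [commute_iff_eq]
    simpa using congrArg (fun p => p.coeff i) (h.smul_eq_mul_C hxy n)
  rw [h.beta_eq hβ]
  refine Commute.sub_right ?_ (hc _ _)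
  cases n with
  | zero => simp [mulX_apply]
  | succ n => rw [coeff_mulX_succ]; exact hc _ _

theorem mul_norm_eq (n : ℕ) : x * E n = E n * y := by
  rw [← h.pairing_self n, ← momentPairing_mul_C m hxy, ← smul_eq_mul, ← map_smul,
    h.smul_eq_mul_C hxy]

theorem norm_inv_mul_eq (n : ℕ) : C n * x = y * C n := by
  calc C n * x = C n * (x * E n) * C n := by
        rw [mul_assoc, mul_assoc, h.norm_mul, mul_one]
    _ = y * C n := by rw [h.mul_norm_eq hxy, ← mul_assoc, h.mul_norm, one_mul]

theorem commute_gamma (n : ℕ) : Commute x (g n) := by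
  cases n with
  | zero => rw [h.gamma_zero]; exact Commute.zero_right x
  | succ n =>
    rw [h.gamma_succ, Commute, SemiconjBy, ← mul_assoc, h.mul_norm_eq hxy, mul_assoc,
      ← h.norm_inv_mul_eq hxy, mul_assoc]

/-- The conjugations by all the `C k` agree on `x`. -/
theorem conj_conj_eq (n k : ℕ) : E n * (C k * x * E k) * C n = x := by
  rw [h.norm_inv_mul_eq hxy k, mul_assoc y, h.mul_norm, mul_one, mul_assoc,
    ← h.norm_inv_mul_eq hxy n, ← mul_assoc, h.norm_mul, one_mul]

end IsOrthogonalSystem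

end Commutation

section Existence

variable {N : ℕ} (m : ℕ → Mat N)

theorem momentPairing_eq_sum_range {R : Type*} [Ring R] (m : ℕ → R) (n k : ℕ) (q : R[X])
    (hq : ∀ i, n ≤ i → q.coeff i = 0) :
    momentPairing m k q = ∑ i : Fin n, q.coeff i * m (i + k) := by
  have e : q = ∑ i ∈ Finset.range n, monomial i (q.coeff i) := by
    ext i
    simp only [finsetSum_coeff, coeff_monomial, Finset.sum_ite_eq', Finset.mem_range]
    split_ifs with hi
    · rfl
    · exact hq i (not_lt.1 hi)
  conv_lhs => rw [e]
  simp only [map_sum, momentPairing_monomial, Finset.sum_range]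

/-- The block Hankel matrix `[m_{j+k}]` for `j, k < n`. -/
def blockHankel (n : ℕ) : Matrix (Fin n × Fin N) (Fin n × Fin N) ℂ :=
  Matrix.of fun p q => m ((p.1 : ℕ) + (q.1 : ℕ)) p.2 q.2

variable {m}

theorem sum_mul_moment (n : ℕ) (B : Matrix (Fin N) (Fin n × Fin N) ℂ) (k : Fin n)
    (r s : Fin N) : (∑ i : Fin n, (Matrix.of fun r a => B r (i, a)) * m (i + k)) r s =
      (B * blockHankel m n) r (k, s) := by
  simp only [Matrix.sum_apply, Matrix.mul_apply, Matrix.of_apply, blockHankel,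
    Fintype.sum_prod_type]

/-- A regular moment problem has a solution among the polynomials of degree less than `n`. -/
theorem exists_momentPairing_eq (n : ℕ) (hn : (blockHankel m n).det ≠ 0) (t : ℕ → Mat N) :
    ∃ q : (Mat N)[X], (∀ i, n ≤ i → q.coeff i = 0) ∧ ∀ k < n, momentPairing m k q = t k := by
  let B : Matrix (Fin N) (Fin n × Fin N) ℂ :=
    (Matrix.of fun r q => t q.1 r q.2) * (blockHankel m n)⁻¹
  let q : (Mat N)[X] := ∑ i : Fin n, monomial (i : ℕ) (Matrix.of fun r a => B r (i, a))
  have hco (i : ℕ) : q.coeff i =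
      if hi : i < n then (Matrix.of fun r a => B r (⟨i, hi⟩, a)) else 0 := by
    simp only [q, finsetSum_coeff, coeff_monomial]
    split_ifs with hi
    · rw [Finset.sum_eq_single ⟨i, hi⟩] <;> simp +contextual [Fin.ext_iff]
    · exact Finset.sum_eq_zero fun j _ => if_neg (by omega)
  have hq : ∀ i, n ≤ i → q.coeff i = 0 := fun i hi => by rw [hco, dif_neg (by omega)]
  refine ⟨q, hq, fun k hk => ?_⟩
  ext r s
  have e := sum_mul_moment (m := m) n B ⟨k, hk⟩ r s
  rw [momentPairing_eq_sum_range m n k q hq]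
  simp only [hco, Fin.is_lt, dif_pos, Fin.eta]
  have hB : B * blockHankel m n = Matrix.of fun r q => t q.1 r q.2 :=
    Matrix.nonsing_inv_mul_cancel_right _ _ (isUnit_iff_ne_zero.2 hn)
  exact e.trans (congrFun (congrFun hB r) _)

theorem eq_zero_of_momentPairing_eq_zero (n : ℕ) (hn : (blockHankel m n).det ≠ 0)
    (q : (Mat N)[X]) (hq : ∀ i, n ≤ i → q.coeff i = 0)
    (hp : ∀ k < n, momentPairing m k q = 0) : q = 0 := by
  let B : Matrix (Fin N) (Fin n × Fin N) ℂ := Matrix.of fun r p => q.coeff p.1 r p.2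
  have hB : B * blockHankel m n = 0 := by
    ext r ⟨k, s⟩
    rw [← sum_mul_moment]
    have e := hp k k.2
    rw [momentPairing_eq_sum_range m n k q hq] at e
    exact congrFun (congrFun e r) s
  have hB0 : B = 0 := by
    rw [← Matrix.mul_nonsing_inv_cancel_right _ B (isUnit_iff_ne_zero.2 hn), hB, Matrix.zero_mul]
  ext i r s
  by_cases hi : n ≤ i
  · simp [hq i hi]
  · exact congrFun (congrFun hB0 r) (⟨i, by omega⟩, s)

/-- Nonsingularity of all block Hankel matrices provides the monic orthogonal polynomials and
makes their norms invertible. -/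
theorem exists_monic_orthogonal (hdet : ∀ n, (blockHankel m (n + 1)).det ≠ 0) (n : ℕ) :
    ∃ p : (Mat N)[X], (∀ i, n < i → p.coeff i = 0) ∧ p.coeff n = 1 ∧
      (∀ k < n, momentPairing m k p = 0) ∧ IsUnit (momentPairing m n p) := by
  have hdet' (n : ℕ) : (blockHankel m n).det ≠ 0 := by
    cases n with
    | zero => rw [Matrix.det_isEmpty]; exact one_ne_zero
    | succ n => exact hdet n
  obtain ⟨q, hq, hqp⟩ := exists_momentPairing_eq n (hdet' n)
    fun k => -momentPairing m k (monomial n 1)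
  obtain ⟨z, hz, hzp⟩ := exists_momentPairing_eq (n + 1) (hdet n) fun k => if k = n then 1 else 0
  have hp : ∀ k < n, momentPairing m k (monomial n 1 + q) = 0 := fun k hk => by
    rw [map_add, hqp k hk, add_neg_cancel]
  have hlead : (monomial n 1 + q).coeff n = 1 := by simp [hq n le_rfl]
  have hgt : ∀ i, n < i → (monomial n (1 : Mat N) + q).coeff i = 0 := fun i hi => by
    simp [coeff_monomial, hi.ne, hq i hi.le]
  refine ⟨monomial n 1 + q, hgt, hlead, hp, ?_⟩
  -- the polynomial with pairings `0, …, 0, 1` is a left multiple of the monic one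
  have e : z = z.coeff n • (monomial n 1 + q) := by
    rw [← sub_eq_zero]
    refine eq_zero_of_momentPairing_eq_zero n (hdet' n) _ (fun i hi => ?_) fun k hk => ?_
    · rw [coeff_sub, coeff_smul]
      rcases hi.eq_or_lt with rfl | hi
      · rw [hlead]; simp
      · rw [hgt i hi, hz i hi]; simp
    · rw [map_sub, map_smul, hp k hk, hzp k (by omega), if_neg (by omega)]; simp
  have h1 := hzp n (Nat.lt_succ_self n)
  rw [if_pos rfl, e, map_smul, smul_eq_mul] at h1
  exact IsUnit.of_mul_eq_one_right _ h1

end Existence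

/-! ### Behaviour of Jacobi type weights at the end points -/

section EndpointEstimates

open Filter Topology Asymptotics MeasureTheory

/-- `f(t) = O(t ^ s)` as `t → 0+` for some exponent `s > -1`. -/
def HasIntegrablePowerBound (f : ℝ → ℂ) : Prop :=
  ∃ s : ℝ, -1 < s ∧ f =O[𝓝[>] 0] fun t : ℝ => t ^ s

theorem isBigO_rpow_rpow_nhdsGT_zero {r s : ℝ} (h : s ≤ r) :
    (fun t : ℝ => t ^ r) =O[𝓝[>] 0] fun t : ℝ => t ^ s := by
  refine IsBigO.of_bound 1 ?_
  filter_upwards [Ioo_mem_nhdsGT (zero_lt_one' ℝ)] with t ht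
  rw [one_mul, Real.norm_of_nonneg (Real.rpow_nonneg ht.1.le _),
    Real.norm_of_nonneg (Real.rpow_nonneg ht.1.le _)]
  exact Real.rpow_le_rpow_of_exponent_ge ht.1 ht.2.le h

theorem HasIntegrablePowerBound.add {f g : ℝ → ℂ} (hf : HasIntegrablePowerBound f)
    (hg : HasIntegrablePowerBound g) : HasIntegrablePowerBound fun t => f t + g t := by
  obtain ⟨r, hr, hf⟩ := hf
  obtain ⟨s, hs, hg⟩ := hg
  exact ⟨min r s, lt_min hr hs,
    (hf.trans (isBigO_rpow_rpow_nhdsGT_zero (min_le_left _ _))).add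
      (hg.trans (isBigO_rpow_rpow_nhdsGT_zero (min_le_right _ _)))⟩

theorem HasIntegrablePowerBound.sum {ι : Type*} (s : Finset ι) {f : ι → ℝ → ℂ}
    (hf : ∀ i ∈ s, HasIntegrablePowerBound (f i)) :
    HasIntegrablePowerBound fun t => ∑ i ∈ s, f i t := by
  classical
  induction s using Finset.induction_on with
  | empty => exact ⟨0, by norm_num, by simp only [Finset.sum_empty]; exact isBigO_zero _ _⟩
  | insert i s hi ih =>
    simp only [Finset.sum_insert hi]
    exact (hf i (Finset.mem_insert_self i s)).add
      (ih fun j hj => hf j (Finset.mem_insert_of_mem hj))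

theorem HasIntegrablePowerBound.congr {f g : ℝ → ℂ} (hf : HasIntegrablePowerBound f)
    (h : f =ᶠ[𝓝[>] 0] g) : HasIntegrablePowerBound g := by
  obtain ⟨s, hs, hf⟩ := hf
  exact ⟨s, hs, hf.congr' h EventuallyEq.rfl⟩

theorem HasIntegrablePowerBound.tendsto_mul {f : ℝ → ℂ} (hf : HasIntegrablePowerBound f)
    {g : ℝ → ℂ} (hg : g =O[𝓝[>] 0] fun t : ℝ => t) :
    Tendsto (fun t => g t * f t) (𝓝[>] 0) (𝓝 0) := by
  obtain ⟨s, hs, hf⟩ := hf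
  refine (hg.mul hf).trans_tendsto ?_
  have h : Tendsto (fun t : ℝ => t ^ (1 + s)) (𝓝[>] 0) (𝓝 0) := by
    have := (Real.continuousAt_rpow_const 0 (1 + s) (Or.inr (by linarith))).tendsto
    rw [Real.zero_rpow (by linarith)] at this
    exact this.mono_left nhdsWithin_le_nhds
  refine h.congr' ?_
  filter_upwards [self_mem_nhdsWithin] with t ht
  rw [Real.rpow_add ht, Real.rpow_one]

theorem HasIntegrablePowerBound.intervalIntegrable_left {f : ℝ → ℂ}
    (hf : HasIntegrablePowerBound f) {c : ℝ} (hc : 0 < c) (hcont : ContinuousOn f (Set.Ioc 0 c)) :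
    IntervalIntegrable f volume 0 c := by
  obtain ⟨s, hs, hf⟩ := hf
  obtain ⟨K, hK⟩ := hf.bound
  obtain ⟨δ, hδ, hb⟩ := mem_nhdsGT_iff_exists_Ioo_subset.1 hK
  set d := min (δ / 2) c
  have hd0 : 0 < d := lt_min (half_pos hδ) hc
  have hdδ : d < δ := (min_le_left _ _).trans_lt (half_lt_self hδ)
  have hdc : d ≤ c := min_le_right _ _
  have h1 : IntervalIntegrable f volume 0 d := by
    have hi := ((intervalIntegral.intervalIntegrable_rpow' (a := 0) (b := d) hs).norm).const_mul K
    rw [intervalIntegrable_iff_integrableOn_Ioc_of_le hd0.le] at hi ⊢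
    refine Integrable.mono' hi ((hcont.mono (Set.Ioc_subset_Ioc_right hdc)).aestronglyMeasurable
      measurableSet_Ioc) ?_
    filter_upwards [ae_restrict_mem measurableSet_Ioc] with t ht
    exact hb ⟨ht.1, ht.2.trans_lt hdδ⟩
  have h2 : IntervalIntegrable f volume d c := by
    refine ContinuousOn.intervalIntegrable (hcont.mono ?_)
    rw [Set.uIcc_of_le hdc]
    exact fun t ht => ⟨hd0.trans_le ht.1, ht.2⟩
  exact h1.trans h2

theorem intervalIntegrable_of_hasIntegrablePowerBound {f : ℝ → ℂ}
    (hcont : ContinuousOn f (Set.Ioo 0 1)) (h0 : HasIntegrablePowerBound f)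
    (h1 : HasIntegrablePowerBound fun t => f (1 - t)) : IntervalIntegrable f volume 0 1 := by
  have i0 : IntervalIntegrable f volume 0 (1 / 2) :=
    h0.intervalIntegrable_left (by norm_num)
      (hcont.mono fun t ht => ⟨ht.1, ht.2.trans_lt (by norm_num)⟩)
  have i1 : IntervalIntegrable (fun t => f (1 - t)) volume 0 (1 / 2) := by
    refine h1.intervalIntegrable_left (by norm_num)
      (hcont.comp (by fun_prop) fun t ht => ⟨?_, ?_⟩)
    · have := ht.2
      linarith
    · have := ht.1
      linarith
  have i2 := i1.comp_sub_left 1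
  norm_num at i2
  exact i0.trans i2.symm

/-- A continuous logarithm of a function with a nonzero limit converges. -/
theorem tendsto_of_tendsto_exp {l : ℝ → ℂ} (hl : ContinuousOn l (Set.Ioo 0 1)) {c : ℂ} (hc : c ≠ 0)
    (h : Tendsto (fun t => Complex.exp (l t)) (𝓝[>] 0) (𝓝 c)) :
    ∃ κ, Tendsto l (𝓝[>] 0) (𝓝 κ) := by
  have h1 : Tendsto (fun t => Complex.exp (l t) / c) (𝓝[>] 0) (𝓝 1) := by
    simpa [hc] using h.div_const c
  have hs : ∀ᶠ t in 𝓝[>] (0 : ℝ), Complex.exp (l t) / c ∈ Complex.slitPlane ∧ t < 1 :=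
    (h1.eventually (Complex.isOpen_slitPlane.mem_nhds Complex.one_mem_slitPlane)).and
      (Eventually.filter_mono nhdsWithin_le_nhds (eventually_lt_nhds one_pos))
  obtain ⟨δ, hδ, hb⟩ := mem_nhdsGT_iff_exists_Ioo_subset.1 hs
  have hsub : Set.Ioo 0 δ ⊆ Set.Ioo (0 : ℝ) 1 := fun t ht => ⟨ht.1, (hb ht).2⟩
  -- the difference to the principal branch takes values in a discrete fibre of `exp`
  have hd : ContinuousOn (fun t => l t - Complex.log (Complex.exp (l t) / c)) (Set.Ioo 0 δ) := by
    have hl' := hl.mono hsub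
    exact hl'.sub ((hl'.cexp.div_const c).clog fun t ht => (hb ht).1)
  have hfib : IsDiscrete (Complex.exp ⁻¹' {c}) := ⟨(Complex.isCoveringMapOn_exp c hc).1⟩
  obtain ⟨y, -, hy⟩ := isPreconnected_Ioo.eqOn_const_of_mapsTo hfib hd (fun t ht => by
    have : Complex.exp (l t) ≠ 0 := Complex.exp_ne_zero _
    rw [Set.mem_preimage, Complex.exp_sub, Complex.exp_log (div_ne_zero this hc)]
    simp only [Set.mem_singleton_iff]
    field_simp) ⟨Complex.log c, by simp [Complex.exp_log hc]⟩
  refine ⟨y + Complex.log 1, ?_⟩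
  refine (((continuousAt_clog Complex.one_mem_slitPlane).tendsto.comp h1).const_add y).congr' ?_
  filter_upwards [Ioo_mem_nhdsGT hδ] with t ht
  have := hy ht
  simp only [Function.const_apply] at this
  simp [← this]

/-- A single term of a Jacobi type weight near an end point.  There `L` is the logarithm that
diverges like `log t` and `M` the one that converges; the powers of `L` are absorbed by lowering
the exponent from `Re a` to `(Re a - 1) / 2`, which still exceeds `-1`. -/
theorem hasIntegrablePowerBound_term {L M ψ : ℝ → ℂ} {κ lam ρ : ℂ}
    (hL : Tendsto (fun t : ℝ => L t - (Real.log t : ℂ)) (𝓝[>] 0) (𝓝 κ))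
    (hM : Tendsto M (𝓝[>] 0) (𝓝 lam)) (hψ : Tendsto ψ (𝓝[>] 0) (𝓝 ρ))
    (a b : ℂ) (ha : -1 < a.re) (p q : ℕ) :
    HasIntegrablePowerBound fun t =>
      ψ t * Complex.exp (a * L t) * Complex.exp (b * M t) * L t ^ p * M t ^ q := by
  have e1 : (fun t => Complex.exp (a * L t)) =O[𝓝[>] 0] fun t : ℝ => t ^ a.re := by
    have hO : (fun t : ℝ => Complex.exp (a * (L t - Real.log t))) =O[𝓝[>] 0] fun _ => (1 : ℝ) :=
      ((hL.const_mul a).cexp).isBigO_one ℝ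
    have hP : (fun t : ℝ => Complex.exp (a * Real.log t)) =O[𝓝[>] 0] fun t : ℝ => t ^ a.re := by
      refine IsBigO.of_bound 1 ?_
      filter_upwards [self_mem_nhdsWithin] with t ht
      rw [Complex.norm_exp, one_mul, Real.norm_of_nonneg (Real.rpow_nonneg (le_of_lt ht) _),
        Real.rpow_def_of_pos ht]
      simp [mul_comm]
    refine ((hO.mul hP).congr (fun t => ?_) fun t => one_mul _)
    rw [← Complex.exp_add]; congr 1; ring
  have hlog : Tendsto (fun t : ℝ => |Real.log t|) (𝓝[>] 0) atTop :=
    tendsto_abs_atBot_atTop.comp Real.tendsto_log_nhdsGT_zero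
  have e2 : L =O[𝓝[>] 0] fun t : ℝ => |Real.log t| := by
    have hO : (fun t : ℝ => L t - Real.log t) =O[𝓝[>] 0] fun t : ℝ => |Real.log t| :=
      (hL.isBigO_one ℝ).trans
        ((isLittleO_const_left.2 (Or.inr (tendsto_norm_atTop_atTop.comp hlog))).isBigO : _)
    have hP : (fun t : ℝ => (Real.log t : ℂ)) =O[𝓝[>] 0] fun t : ℝ => |Real.log t| :=
      isBigO_of_le _ fun t => by simp
    exact (hO.add hP).congr_left fun t => sub_add_cancel _ _
  have hε : 0 < (a.re + 1) / 2 := by linarith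
  have e3 : (fun t => L t ^ p) =O[𝓝[>] 0] fun t : ℝ => t ^ (-((a.re + 1) / 2)) := by
    refine (e2.pow p).trans (IsLittleO.isBigO ?_)
    simpa using isLittleO_abs_log_rpow_rpow_nhdsGT_zero (p : ℝ) (neg_lt_zero.2 hε)
  have e4 : (fun t => Complex.exp (b * M t)) =O[𝓝[>] 0] fun _ => (1 : ℝ) :=
    ((hM.const_mul b).cexp).isBigO_one ℝ
  have e5 : (fun t => M t ^ q) =O[𝓝[>] 0] fun _ => (1 : ℝ) := (hM.pow q).isBigO_one ℝ
  refine ⟨(a.re - 1) / 2, by linarith, ?_⟩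
  refine (((((hψ.isBigO_one ℝ).mul e1).mul e4).mul e3).mul e5).congr' EventuallyEq.rfl ?_
  filter_upwards [self_mem_nhdsWithin] with t ht
  rw [one_mul, mul_one, mul_one, ← Real.rpow_add ht]
  congr 1; ring

end EndpointEstimates

section JacobiType

open Filter Topology Asymptotics MeasureTheory

theorem tendsto_div_of_hasDerivWithinAt {f : ℝ → ℂ} {f' : ℂ}
    (hf : HasDerivWithinAt f f' (Set.Icc 0 1) 0) (h0 : f 0 = 0) :
    Tendsto (fun t : ℝ => f t / t) (𝓝[>] 0) (𝓝 f') := by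
  have h := hasDerivWithinAt_iff_tendsto_slope.1 hf
  have hle : 𝓝[>] (0 : ℝ) ≤ 𝓝[Set.Icc (0 : ℝ) 1 \ {0}] 0 := by
    rw [nhdsWithin, nhdsWithin, le_inf_iff]
    refine ⟨inf_le_left, le_principal_iff.2 ?_⟩
    filter_upwards [Ioo_mem_nhdsGT (zero_lt_one' ℝ)] with t ht
    exact ⟨⟨ht.1.le, ht.2.le⟩, ht.1.ne'⟩
  refine (h.mono_left hle).congr fun t => ?_
  rw [slope_def_module, h0, sub_zero, sub_zero, Complex.real_smul]
  push_cast
  ring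

/-- Near an end point at which `g` vanishes to first order, a continuous determination of
`log g` is `log t` up to a convergent term. -/
theorem tendsto_sub_log {g l : ℝ → ℂ} (hl : ContinuousOn l (Set.Ioo 0 1))
    (hg : ∀ t ∈ Set.Ioo (0 : ℝ) 1, Complex.exp (l t) = g t) {c : ℂ} (hc : c ≠ 0)
    (h : Tendsto (fun t : ℝ => g t / t) (𝓝[>] 0) (𝓝 c)) :
    ∃ κ, Tendsto (fun t : ℝ => l t - (Real.log t : ℂ)) (𝓝[>] 0) (𝓝 κ) := by
  refine tendsto_of_tendsto_exp (hl.sub ?_) hc (h.congr' ?_)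
  · exact Complex.continuous_ofReal.comp_continuousOn
      (Real.continuousOn_log.mono fun t ht => ht.1.ne')
  · filter_upwards [Ioo_mem_nhdsGT (zero_lt_one' ℝ)] with t ht
    rw [Complex.exp_sub, hg t ht, ← Complex.ofReal_exp, Real.exp_log ht.1]

theorem deriv_eq_derivWithin_Icc {γ : ℝ → ℂ} {t : ℝ} (ht : t ∈ Set.Ioo (0 : ℝ) 1) :
    deriv γ t = derivWithin γ (Set.Icc 0 1) t :=
  (derivWithin_of_mem_nhds (Icc_mem_nhds ht.1 ht.2)).symm

namespace IsSupportCurve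

variable {γ : ℝ → ℂ} (hγ : IsSupportCurve γ)

include hγ

theorem continuousOn : ContinuousOn γ (Set.Icc 0 1) := hγ.smooth.continuousOn

theorem hasDerivWithinAt {t : ℝ} (ht : t ∈ Set.Icc (0 : ℝ) 1) :
    HasDerivWithinAt γ (derivWithin γ (Set.Icc 0 1) t) (Set.Icc 0 1) t :=
  (hγ.smooth.differentiableOn one_ne_zero t ht).hasDerivWithinAt

theorem hasDerivAt {t : ℝ} (ht : t ∈ Set.Ioo (0 : ℝ) 1) : HasDerivAt γ (deriv γ t) t := by
  rw [deriv_eq_derivWithin_Icc ht]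
  exact (hγ.hasDerivWithinAt (Set.Ioo_subset_Icc_self ht)).hasDerivAt (Icc_mem_nhds ht.1 ht.2)

theorem continuousOn_derivWithin : ContinuousOn (derivWithin γ (Set.Icc 0 1)) (Set.Icc 0 1) :=
  hγ.smooth.continuousOn_derivWithin (uniqueDiffOn_Icc one_pos) le_rfl

theorem tendsto_zero : Tendsto γ (𝓝[>] 0) (𝓝 0) := by
  have h := hγ.continuousOn 0 (by simp)
  rw [ContinuousWithinAt, hγ.source] at h
  exact h.mono_left (nhdsWithin_le_of_mem (mem_of_superset (Ioo_mem_nhdsGT one_pos)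
    Set.Ioo_subset_Icc_self))

theorem tendsto_div : Tendsto (fun t : ℝ => γ t / t) (𝓝[>] 0)
    (𝓝 (derivWithin γ (Set.Icc 0 1) 0)) :=
  tendsto_div_of_hasDerivWithinAt (hγ.hasDerivWithinAt (by simp)) hγ.source

/-- `1 - z` vanishes to first order at the end point `1` of the arc. -/
theorem tendsto_div_reverse : Tendsto (fun t : ℝ => (1 - γ (1 - t)) / t) (𝓝[>] 0)
    (𝓝 (derivWithin γ (Set.Icc 0 1) 1)) := by
  refine tendsto_div_of_hasDerivWithinAt ?_ (by simp [hγ.target])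
  have h1 : HasDerivWithinAt (fun t : ℝ => 1 - t) (-1) (Set.Icc 0 1) 0 :=
    ((hasDerivAt_id (0 : ℝ)).const_sub 1).hasDerivWithinAt
  have h2 := hγ.hasDerivWithinAt (t := 1 - 0) (by simp)
  have h3 := (h2.scomp (0 : ℝ) h1 (fun t ht => by
    constructor <;> [linarith [ht.2]; linarith [ht.1]])).const_sub 1
  simpa using h3

theorem tendsto_one : Tendsto (fun t => γ (1 - t)) (𝓝[>] 0) (𝓝 1) := by
  have h := hγ.continuousOn 1 (by simp)
  rw [ContinuousWithinAt, hγ.target] at h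
  refine h.comp (tendsto_nhdsWithin_iff.2 ⟨?_, ?_⟩)
  · have : Tendsto (fun t : ℝ => 1 - t) (𝓝 0) (𝓝 (1 - 0)) :=
      (continuous_const.sub continuous_id).tendsto 0
    rw [sub_zero] at this
    exact this.mono_left nhdsWithin_le_nhds
  · filter_upwards [Ioo_mem_nhdsGT (zero_lt_one' ℝ)] with t ht
    constructor <;> [linarith [ht.2]; linarith [ht.1]]

end IsSupportCurve

variable {N : ℕ} {γ : ℝ → ℂ} {W : ℂ → Mat N}

theorem reverse_mem_Ioo {t : ℝ} (ht : t ∈ Set.Ioo (0 : ℝ) 1) : 1 - t ∈ Set.Ioo (0 : ℝ) 1 :=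
  ⟨by linarith [ht.2], by linarith [ht.1]⟩

theorem continuousOn_reverse {l : ℝ → ℂ} (hl : ContinuousOn l (Set.Ioo 0 1)) :
    ContinuousOn (fun t => l (1 - t)) (Set.Ioo 0 1) :=
  hl.comp (continuous_const.sub continuous_id).continuousOn fun _ ht => reverse_mem_Ioo ht

/-- The entries of a Jacobi type weight are continuous on the open arc and bounded by integrable
powers at both end points. -/
theorem IsJacobiType.bounds (hγ : IsSupportCurve γ) (hJ : IsJacobiType γ W) (j k : Fin N) :
    ContinuousOn (fun t => W (γ t) j k) (Set.Ioo 0 1) ∧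
    HasIntegrablePowerBound (fun t => W (γ t) j k) ∧
    HasIntegrablePowerBound (fun t => W (γ (1 - t)) j k) := by
  obtain ⟨l₀, l₁, hl₀, hl₁, hexp, hW⟩ := hJ
  obtain ⟨n, φ, a, b, p, q, hφ, hW⟩ := hW j k
  have hIoo : Set.Ioo (0 : ℝ) 1 ∈ 𝓝[>] (0 : ℝ) := Ioo_mem_nhdsGT one_pos
  have hsub : Set.Ioo (0 : ℝ) 1 ⊆ Set.Icc 0 1 := Set.Ioo_subset_Icc_self
  refine ⟨?_, ?_, ?_⟩
  · refine ContinuousOn.congr ?_ hW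
    refine continuousOn_finsetSum _ fun i _ => ?_
    have := (hφ i).1.continuous.comp_continuousOn (hγ.continuousOn.mono hsub)
    exact (((this.mul (continuousOn_const.mul hl₀).cexp).mul
      (continuousOn_const.mul hl₁).cexp).mul (hl₀.pow _)).mul (hl₁.pow _)
  · obtain ⟨κ, hκ⟩ := tendsto_sub_log hl₀ (fun t ht => (hexp t ht).1)
      (hγ.regular 0 (by simp)) hγ.tendsto_div
    obtain ⟨lam, hlam⟩ := tendsto_of_tendsto_exp hl₁ one_ne_zero
      ((show Tendsto (fun t => 1 - γ t) (𝓝[>] 0) (𝓝 1) by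
        simpa using hγ.tendsto_zero.const_sub 1).congr' (by
          filter_upwards [hIoo] with t ht using (hexp t ht).2.symm))
    refine HasIntegrablePowerBound.congr (HasIntegrablePowerBound.sum Finset.univ fun i _ =>
      hasIntegrablePowerBound_term hκ hlam
        (((hφ i).1.continuous.tendsto _).comp hγ.tendsto_zero) (a i) (b i) (hφ i).2.2.1 (p i) (q i)) ?_
    filter_upwards [hIoo] with t ht using (hW t ht).symm
  · obtain ⟨κ, hκ⟩ := tendsto_sub_log (continuousOn_reverse hl₁)
      (fun t ht => (hexp _ (reverse_mem_Ioo ht)).2)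
      (hγ.regular 1 (by simp)) hγ.tendsto_div_reverse
    obtain ⟨lam, hlam⟩ := tendsto_of_tendsto_exp (continuousOn_reverse hl₀) one_ne_zero
      (hγ.tendsto_one.congr' (by
          filter_upwards [hIoo] with t ht using (hexp _ (reverse_mem_Ioo ht)).1.symm))
    refine HasIntegrablePowerBound.congr (HasIntegrablePowerBound.sum Finset.univ fun i _ =>
      hasIntegrablePowerBound_term hκ hlam
        (((hφ i).1.continuous.tendsto _).comp hγ.tendsto_one) (b i) (a i) (hφ i).2.2.2 (q i) (p i)) ?_
    filter_upwards [hIoo] with t ht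
    rw [hW _ (reverse_mem_Ioo ht)]
    refine Finset.sum_congr rfl fun i _ => ?_
    simp only [Function.comp_apply]
    ring

end JacobiType

/-! ### Moments and the Pearson equation -/

section ContourIntegral

open Filter Topology Asymptotics MeasureTheory

theorem isBigO_of_tendsto_div {g : ℝ → ℂ} {c : ℂ}
    (h : Tendsto (fun t : ℝ => g t / t) (𝓝[>] 0) (𝓝 c)) : g =O[𝓝[>] 0] fun t : ℝ => t := by
  have h := (h.isBigO_one ℝ).mul
    (isBigO_of_le (𝓝[>] 0) (f := fun t : ℝ => (t : ℂ)) (g := fun t : ℝ => t) fun t => by simp)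
  refine h.congr' ?_ (Eventually.of_forall fun t => one_mul _)
  filter_upwards [self_mem_nhdsWithin] with t ht
  exact div_mul_cancel₀ _ (Complex.ofReal_ne_zero.2 (ne_of_gt ht))

variable {N : ℕ} {γ : ℝ → ℂ}

/-- All entries of `F` are integrable along `γ`. -/
def ContourIntegrable (γ : ℝ → ℂ) (F : ℂ → Mat N) : Prop :=
  ∀ i j, IntervalIntegrable (fun t => F (γ t) i j * deriv γ t) volume 0 1

variable {F G : ℂ → Mat N}

theorem ContourIntegrable.add (hF : ContourIntegrable γ F) (hG : ContourIntegrable γ G) :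
    ContourIntegrable γ fun z => F z + G z := fun i j => by
  simpa [add_mul] using (hF i j).add (hG i j)

theorem ContourIntegrable.sub (hF : ContourIntegrable γ F) (hG : ContourIntegrable γ G) :
    ContourIntegrable γ fun z => F z - G z := fun i j => by
  simpa [sub_mul] using (hF i j).sub (hG i j)

theorem ContourIntegrable.sum_const_mul (hF : ContourIntegrable γ F) (A : Mat N) (i j : Fin N) :
    ∀ l ∈ Finset.univ,
      IntervalIntegrable (fun t => A i l * (F (γ t) l j * deriv γ t)) volume 0 1 :=
  fun l _ => (hF l j).const_mul (A i l)

theorem ContourIntegrable.sum_mul_const (hF : ContourIntegrable γ F) (A : Mat N) (i j : Fin N) :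
    ∀ l ∈ Finset.univ,
      IntervalIntegrable (fun t => A l j * (F (γ t) i l * deriv γ t)) volume 0 1 :=
  fun l _ => (hF i l).const_mul (A l j)

theorem ContourIntegrable.const_mul (hF : ContourIntegrable γ F) (A : Mat N) :
    ContourIntegrable γ fun z => A * F z := fun i j => by
  have h := IntervalIntegrable.sum _ (hF.sum_const_mul A i j)
  simp only [Finset.sum_fn] at h
  simpa [Matrix.mul_apply, Finset.sum_mul, mul_assoc] using h

theorem contourInt_add (hF : ContourIntegrable γ F) (hG : ContourIntegrable γ G) :
    contourInt γ (fun z => F z + G z) = contourInt γ F + contourInt γ G := by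
  ext i j
  simp only [contourInt, Matrix.of_apply, Matrix.add_apply, add_mul]
  rw [intervalIntegral.integral_add (hF i j) (hG i j), mul_add]

theorem contourInt_sub (hF : ContourIntegrable γ F) (hG : ContourIntegrable γ G) :
    contourInt γ (fun z => F z - G z) = contourInt γ F - contourInt γ G := by
  ext i j
  simp only [contourInt, Matrix.of_apply, Matrix.sub_apply, sub_mul]
  rw [intervalIntegral.integral_sub (hF i j) (hG i j), mul_sub]

theorem contourInt_const_mul (hF : ContourIntegrable γ F) (A : Mat N) :
    contourInt γ (fun z => A * F z) = A * contourInt γ F := by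
  ext i j
  simp only [contourInt, Matrix.of_apply, Matrix.mul_apply, Finset.sum_mul, mul_assoc]
  rw [intervalIntegral.integral_finsetSum (hF.sum_const_mul A i j)]
  simp only [Finset.mul_sum, intervalIntegral.integral_const_mul]
  exact Finset.sum_congr rfl fun l _ => by ring

theorem contourInt_mul_const (hF : ContourIntegrable γ F) (A : Mat N) :
    contourInt γ (fun z => F z * A) = contourInt γ F * A := by
  ext i j
  have e (t : ℝ) : ∑ l, F (γ t) i l * (A l j * deriv γ t) =
      ∑ l, A l j * (F (γ t) i l * deriv γ t) := Finset.sum_congr rfl fun l _ => by ring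
  simp only [contourInt, Matrix.of_apply, Matrix.mul_apply, Finset.sum_mul, mul_assoc, e]
  rw [intervalIntegral.integral_finsetSum (hF.sum_mul_const A i j)]
  simp only [Finset.mul_sum, intervalIntegral.integral_const_mul]
  exact Finset.sum_congr rfl fun l _ => by ring

theorem contourInt_congr (h : ∀ t ∈ Set.Ioo (0 : ℝ) 1, F (γ t) = G (γ t)) :
    contourInt γ F = contourInt γ G := by
  ext i j
  simp only [contourInt, Matrix.of_apply]
  rw [intervalIntegral.integral_of_le zero_le_one, intervalIntegral.integral_of_le zero_le_one,
    integral_Ioc_eq_integral_Ioo, integral_Ioc_eq_integral_Ioo]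
  rw [setIntegral_congr_fun (g := fun t => G (γ t) i j * deriv γ t) measurableSet_Ioo
    fun t ht => by simp only [h t ht]]

variable {W : ℂ → Mat N} (hγ : IsSupportCurve γ) (hJ : IsJacobiType γ W)

include hγ hJ

theorem contourIntegrable_pow_smul (n : ℕ) : ContourIntegrable γ fun z => z ^ n • W z := by
  intro i j
  obtain ⟨hc, h0, h1⟩ := hJ.bounds hγ i j
  have hw := intervalIntegrable_of_hasIntegrablePowerBound hc h0 h1
  have hcont : ContinuousOn (fun t => γ t ^ n * derivWithin γ (Set.Icc 0 1) t)
      (Set.uIcc 0 1) := by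
    rw [Set.uIcc_of_le zero_le_one]
    exact (hγ.continuousOn.pow n).mul hγ.continuousOn_derivWithin
  have h := hw.mul_continuousOn hcont
  rw [intervalIntegrable_iff_integrableOn_Ioo_of_le zero_le_one] at h ⊢
  refine h.congr_fun (fun t ht => ?_) measurableSet_Ioo
  simp only [Matrix.smul_apply, smul_eq_mul, deriv_eq_derivWithin_Icc ht]
  ring

/-- The integrals in the definition of left orthogonality are pairings with the moments. -/
theorem contourInt_eval_mul (k : ℕ) (p : (Mat N)[X]) :
    contourInt γ (fun z => z ^ k • (p.eval (Matrix.scalar (Fin N) z) * W z)) =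
      momentPairing (moment γ W) k p := by
  have key : ContourIntegrable γ
        (fun z => z ^ k • (p.eval (Matrix.scalar (Fin N) z) * W z)) ∧
      contourInt γ (fun z => z ^ k • (p.eval (Matrix.scalar (Fin N) z) * W z)) =
        momentPairing (moment γ W) k p := by
    induction p using Polynomial.induction_on' with
    | add p q hp hq =>
      simp only [eval_add, add_mul, smul_add, map_add, ← hp.2, ← hq.2]
      exact ⟨hp.1.add hq.1, contourInt_add hp.1 hq.1⟩
    | monomial j A =>
      have e : (fun z => z ^ k • ((monomial j A).eval (Matrix.scalar (Fin N) z) * W z)) =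
          fun z => A * (z ^ (j + k) • W z) := by
        funext z
        rw [eval_monomial, ← map_pow, Matrix.scalar_apply, ← Matrix.smul_one_eq_diagonal,
          mul_smul_comm, mul_one, smul_mul_assoc, smul_smul, ← pow_add, mul_smul_comm, add_comm]
      rw [e, momentPairing_monomial]
      have hi := contourIntegrable_pow_smul hγ hJ (j + k)
      exact ⟨hi.const_mul A, contourInt_const_mul hi A⟩
  exact key.2

variable {h₀ h₁ h₂ : Mat N} (hW : SatisfiesPearson γ W h₀ h₁ h₂)

omit hJ in
theorem ne_zero_and_ne_one {t : ℝ} (ht : t ∈ Set.Ioo (0 : ℝ) 1) : γ t ≠ 0 ∧ γ t ≠ 1 := by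
  have h := hγ.circle
  constructor
  · intro h0
    have := h (Set.Ioo_subset_Icc_self ht) (Set.left_mem_Icc.2 zero_le_one)
      (by simp [h0, hγ.source])
    exact ht.1.ne' this
  · intro h0
    have := h (Set.Ioo_subset_Icc_self ht) (Set.right_mem_Icc.2 zero_le_one)
      (by simp [h0, hγ.target])
    exact ht.2.ne this

/-- The coefficient matrix of the linear differential equation that the Pearson equation imposes
on `t ↦ W (γ t)`. -/
def pearsonCoeff (γ : ℝ → ℂ) (h₀ h₁ h₂ : Mat N) (t : ℝ) : Mat N :=
  (deriv γ t * (γ t * (1 - γ t))⁻¹) • (h₀ + γ t • h₁ + γ t ^ 2 • h₂)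

include hW

omit hJ in
theorem hasDerivAt_weight {t : ℝ} (ht : t ∈ Set.Ioo (0 : ℝ) 1) (i j : Fin N) :
    HasDerivAt (fun t => W (γ t) i j) ((pearsonCoeff γ h₀ h₁ h₂ t * W (γ t)) i j) t := by
  obtain ⟨W', hd, he⟩ := hW (γ t) ⟨t, ht, rfl⟩
  obtain ⟨h0, h1⟩ := ne_zero_and_ne_one hγ ht
  have hne : γ t * (1 - γ t) ≠ 0 := mul_ne_zero h0 (sub_ne_zero.2 h1.symm)
  have hs := (hd i j).scomp t (hγ.hasDerivAt ht).hasDerivWithinAt (Set.mapsTo_image γ _)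
  refine (hs.hasDerivAt (Ioo_mem_nhds ht.1 ht.2)).congr_deriv ?_
  rw [pearsonCoeff, smul_mul_assoc, ← he, smul_smul, mul_assoc, inv_mul_cancel₀ hne, mul_one,
    Matrix.smul_apply]

/-- The recurrence for the moments that results from integrating the Pearson equation by parts;
the boundary terms vanish because the exponents at the end points exceed `-1`. -/
theorem moment_recurrence (k : ℕ) :
    ((k : Mat N) + 1) * moment γ W k - ((k : Mat N) + 2) * moment γ W (k + 1)
      + (h₀ * moment γ W k + h₁ * moment γ W (k + 1) + h₂ * moment γ W (k + 2)) = 0 := by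
  have I := contourIntegrable_pow_smul hγ hJ
  have I1 := (I k).const_mul ((k : Mat N) + 1)
  have I2 := (I (k + 1)).const_mul ((k : Mat N) + 2)
  have J0 := (I k).const_mul h₀
  have J1 := (I (k + 1)).const_mul h₁
  have J2 := (I (k + 2)).const_mul h₂
  simp only [moment]
  rw [← contourInt_const_mul (I k), ← contourInt_const_mul (I (k + 1)),
    ← contourInt_const_mul (I k), ← contourInt_const_mul (I (k + 1)),
    ← contourInt_const_mul (I (k + 2)), ← contourInt_sub I1 I2, ← contourInt_add J0 J1,
    ← contourInt_add (J0.add J1) J2, ← contourInt_add (I1.sub I2) ((J0.add J1).add J2)]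
  have Iall := (I1.sub I2).add ((J0.add J1).add J2)
  ext i j
  obtain ⟨-, b0, b1⟩ := hJ.bounds hγ i j
  have hγ0 := isBigO_of_tendsto_div hγ.tendsto_div
  have hγ1 := isBigO_of_tendsto_div hγ.tendsto_div_reverse
  have t0 : Tendsto (fun t => γ t * (γ t ^ k * (1 - γ t)) * W (γ t) i j) (𝓝[>] 0) (𝓝 0) := by
    refine b0.tendsto_mul ?_
    have h := hγ0.mul (((hγ.tendsto_zero.pow k).mul (hγ.tendsto_zero.const_sub 1)).isBigO_one ℝ)
    simpa using h
  -- the same boundary term at the other end point, through `t ↦ 1 - t`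
  have t1 : Tendsto (fun t => γ t * (γ t ^ k * (1 - γ t)) * W (γ t) i j) (𝓝[<] 1) (𝓝 0) := by
    have h := hγ1.mul ((hγ.tendsto_one.pow (k + 1)).isBigO_one ℝ)
    have h' := b1.tendsto_mul (g := fun t => (1 - γ (1 - t)) * γ (1 - t) ^ (k + 1))
      (by simpa using h)
    have hr : Tendsto (fun t : ℝ => 1 - t) (𝓝[<] 1) (𝓝[>] 0) := by
      refine tendsto_nhdsWithin_iff.2 ⟨?_, ?_⟩
      · have : Tendsto (fun t : ℝ => 1 - t) (𝓝 1) (𝓝 (1 - 1)) :=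
          (continuous_const.sub continuous_id).tendsto 1
        rw [sub_self] at this
        exact this.mono_left nhdsWithin_le_nhds
      · filter_upwards [self_mem_nhdsWithin] with t ht
        simpa using ht
    refine (h'.comp hr).congr fun t => ?_
    simp only [Function.comp_apply, sub_sub_cancel]
    ring
  have hFTC := intervalIntegral.integral_eq_sub_of_hasDerivAt_of_tendsto zero_lt_one
    (f' := fun t => _) (fun t ht => ?_) (Iall i j) t0 t1
  · simp only [contourInt, Matrix.of_apply, Matrix.zero_apply]
    rw [hFTC, sub_self, mul_zero]
  · have hd := hγ.hasDerivAt ht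
    have h := (hd.mul ((hd.pow k).mul (hd.const_sub 1))).mul (hasDerivAt_weight hγ hW ht i j)
    refine h.congr_deriv ?_
    obtain ⟨h0, h1⟩ := ne_zero_and_ne_one hγ ht
    have hne : γ t * (1 - γ t) ≠ 0 := mul_ne_zero h0 (sub_ne_zero.2 h1.symm)
    have e : γ t * (γ t ^ k * (1 - γ t)) * (pearsonCoeff γ h₀ h₁ h₂ t * W (γ t)) i j =
        γ t ^ k * deriv γ t * ((h₀ + γ t • h₁ + γ t ^ 2 • h₂) * W (γ t)) i j := by
      rw [pearsonCoeff, smul_mul_assoc, Matrix.smul_apply, smul_eq_mul]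
      field_simp
    have hcast (c : ℕ) (d : ℂ) (M : Mat N) : ((k : Mat N) + c) * (d • M) = ((k + c) * d) • M := by
      rw [← Nat.cast_add, ← nsmul_eq_mul, ← Nat.cast_smul_eq_nsmul ℂ, smul_smul, Nat.cast_add]
    have h1' := hcast 1
    have h2' := hcast 2
    push_cast at h1' h2'
    simp only [Pi.mul_apply, Pi.pow_apply]
    rw [e, h1', h2']
    simp only [Matrix.add_apply, Matrix.sub_apply, Matrix.smul_apply, smul_eq_mul, mul_smul_comm,
      add_mul, smul_mul_assoc]
    cases k with
    | zero => push_cast; ring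
    | succ k => simp only [Nat.add_sub_cancel]; push_cast; ring

end ContourIntegral

section LinearODE

/-- Uniqueness for linear systems of differential equations on the open unit interval, with a
coefficient matrix that may be unbounded near the end points. -/
theorem eq_zero_of_linear_ode {N : ℕ} {A V : ℝ → Mat N}
    (hA : ∀ i j, ContinuousOn (fun t => A t i j) (Set.Ioo 0 1))
    (hV : ∀ t ∈ Set.Ioo (0 : ℝ) 1, ∀ i j, HasDerivAt (fun t => V t i j) ((A t * V t) i j) t)
    {t₀ : ℝ} (ht₀ : t₀ ∈ Set.Ioo (0 : ℝ) 1) (h0 : V t₀ = 0) :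
    ∀ t ∈ Set.Ioo (0 : ℝ) 1, V t = 0 := by
  intro t ht
  ext i j
  -- on a compact subinterval the equation is Lipschitz
  obtain ⟨a, ha0, ha⟩ := exists_between (lt_min ht₀.1 ht.1)
  obtain ⟨b, hb, hb1⟩ := exists_between (max_lt ht₀.2 ht.2)
  have hsub : Set.Icc a b ⊆ Set.Ioo 0 1 := fun s hs => ⟨ha0.trans_le hs.1, hs.2.trans_lt hb1⟩
  have hcont : ContinuousOn (fun t => ∑ i, ∑ j, ‖A t i j‖) (Set.Icc a b) :=
    continuousOn_finsetSum _ fun i _ => continuousOn_finsetSum _ fun j _ =>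
      ((hA i j).mono hsub).norm
  obtain ⟨K, hK⟩ := isCompact_Icc.bddAbove_image hcont
  have hlip : ∀ s ∈ Set.Ioo a b,
      LipschitzOnWith K.toNNReal (fun y : Fin N → ℂ => Matrix.mulVec (A s) y) Set.univ := by
    intro s hs
    have hKs : ∑ i, ∑ j, ‖A s i j‖ ≤ K := hK ⟨s, Set.Ioo_subset_Icc_self hs, rfl⟩
    refine LipschitzOnWith.of_dist_le_mul fun x _ y _ => ?_
    rw [dist_eq_norm, dist_eq_norm, ← Matrix.mulVec_sub]
    refine (pi_norm_le_iff_of_nonneg (by positivity)).2 fun l => ?_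
    calc ‖Matrix.mulVec (A s) (x - y) l‖ ≤ ∑ j, ‖A s l j * (x - y) j‖ :=
          norm_sum_le Finset.univ fun j => A s l j * (x - y) j
      _ ≤ ∑ j, ‖A s l j‖ * ‖x - y‖ := Finset.sum_le_sum fun j _ => by
          rw [norm_mul]; gcongr; exact norm_le_pi_norm (x - y) j
      _ = (∑ j, ‖A s l j‖) * ‖x - y‖ := (Finset.sum_mul ..).symm
      _ ≤ K.toNNReal * ‖x - y‖ := by
          gcongr
          refine le_trans ?_ (hKs.trans (Real.le_coe_toNNReal K))
          exact Finset.single_le_sum (f := fun l => ∑ j, ‖A s l j‖)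
            (fun _ _ => Finset.sum_nonneg fun _ _ => norm_nonneg _) (Finset.mem_univ l)
  have hsol := ODE_solution_unique_of_mem_Ioo (v := fun s y => Matrix.mulVec (A s) y)
    (f := fun s l => V s l j) (g := fun _ => 0) hlip (t₀ := t₀)
    ⟨ha.trans_le (min_le_left _ _), (le_max_left _ _).trans_lt hb⟩
    (fun s hs => ⟨hasDerivAt_pi.2 fun l => hV s (hsub (Set.Ioo_subset_Icc_self hs)) l j,
      Set.mem_univ _⟩)
    (fun s _ => ⟨by simpa using hasDerivAt_const s (0 : Fin N → ℂ), Set.mem_univ _⟩)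
    (by funext l; simp [h0])
  exact congrFun (hsol ⟨ha.trans_le (min_le_right _ _), (le_max_right _ _).trans_lt hb⟩) i

end LinearODE

/-! ### Matrices commuting with the Pearson coefficients -/

section Intertwining

variable {N : ℕ} {γ : ℝ → ℂ} {W : ℂ → Mat N} {h₀ h₁ h₂ : Mat N}

theorem continuousOn_pearsonCoeff (hγ : IsSupportCurve γ) (i j : Fin N) :
    ContinuousOn (fun t => pearsonCoeff γ h₀ h₁ h₂ t i j) (Set.Ioo 0 1) := by
  have hc := hγ.continuousOn.mono Set.Ioo_subset_Icc_self
  have hd : ContinuousOn (deriv γ) (Set.Ioo 0 1) :=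
    (hγ.continuousOn_derivWithin.mono Set.Ioo_subset_Icc_self).congr
      fun t ht => deriv_eq_derivWithin_Icc ht
  have hi : ContinuousOn (fun t => (γ t * (1 - γ t))⁻¹) (Set.Ioo 0 1) :=
    (hc.mul (continuousOn_const.sub hc)).inv₀ fun t ht => by
      obtain ⟨h0, h1⟩ := ne_zero_and_ne_one hγ ht
      exact mul_ne_zero h0 (sub_ne_zero.2 h1.symm)
  simp only [pearsonCoeff, Matrix.smul_apply, Matrix.add_apply, smul_eq_mul]
  exact (hd.mul hi).mul ((continuousOn_const.add (hc.mul continuousOn_const)).add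
    ((hc.pow 2).mul continuousOn_const))

theorem commute_pearsonCoeff {x : Mat N} (h0 : Commute x h₀) (h1 : Commute x h₁)
    (h2 : Commute x h₂) (t : ℝ) : Commute x (pearsonCoeff γ h₀ h₁ h₂ t) :=
  ((h0.add_right (h1.smul_right _)).add_right (h2.smul_right _)).smul_right _

theorem hasDerivAt_const_mul_apply {V : ℝ → Mat N} {V' : Mat N} {t : ℝ}
    (hV : ∀ i j, HasDerivAt (fun t => V t i j) (V' i j) t) (B : Mat N) (i j : Fin N) :
    HasDerivAt (fun t => (B * V t) i j) ((B * V') i j) t := by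
  simp only [Matrix.mul_apply]
  exact HasDerivAt.fun_sum fun l _ => (hV l j).const_mul (B i l)

theorem hasDerivAt_mul_const_apply {V : ℝ → Mat N} {V' : Mat N} {t : ℝ}
    (hV : ∀ i j, HasDerivAt (fun t => V t i j) (V' i j) t) (B : Mat N) (i j : Fin N) :
    HasDerivAt (fun t => (V t * B) i j) ((V' * B) i j) t := by
  simp only [Matrix.mul_apply]
  exact HasDerivAt.fun_sum fun l _ => (hV i l).mul_const (B l j)

variable (hγ : IsSupportCurve γ) (hW : SatisfiesPearson γ W h₀ h₁ h₂)

include hγ hW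

/-- If `x` commutes with the coefficients of the Pearson equation, then `x W` and
`W (M⁻¹ x M)`, with `M` a value of `W`, solve the same initial value problem. -/
theorem mul_weight_eq {x : Mat N} (h0 : Commute x h₀) (h1 : Commute x h₁) (h2 : Commute x h₂)
    {t₀ : ℝ} (ht₀ : t₀ ∈ Set.Ioo (0 : ℝ) 1) {y : Mat N} (hxy : x * W (γ t₀) = W (γ t₀) * y)
    {t : ℝ} (ht : t ∈ Set.Ioo (0 : ℝ) 1) : x * W (γ t) = W (γ t) * y := by
  refine sub_eq_zero.1 (eq_zero_of_linear_ode (A := pearsonCoeff γ h₀ h₁ h₂)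
    (V := fun t => x * W (γ t) - W (γ t) * y) (continuousOn_pearsonCoeff hγ)
    (fun s hs i j => ?_) ht₀ (sub_eq_zero.2 hxy) t ht)
  have hd := hasDerivAt_weight hγ hW hs
  refine ((hasDerivAt_const_mul_apply hd x i j).sub
    (hasDerivAt_mul_const_apply hd y i j)).congr_deriv ?_
  rw [mul_sub, ← mul_assoc x, (commute_pearsonCoeff h0 h1 h2 s).eq, mul_assoc _ x,
    ← mul_assoc _ (W (γ s)) y]
  rfl

/-- The weight is invertible on the open arc: otherwise the uniqueness of solutions would propagate
a kernel vector along the arc, and it would annihilate the moments. -/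
theorem isUnit_weight (hJ : IsJacobiType γ W) (hdet : IsUnit (moment γ W 0)) {t₀ : ℝ}
    (ht₀ : t₀ ∈ Set.Ioo (0 : ℝ) 1) : IsUnit (W (γ t₀)) := by
  rw [Matrix.isUnit_iff_isUnit_det, isUnit_iff_ne_zero]
  intro hz
  obtain ⟨v, hv, hMv⟩ := Matrix.exists_mulVec_eq_zero_iff.2 hz
  -- a kernel vector at one point of the arc annihilates the weight everywhere
  set B : Mat N := Matrix.vecMulVec v v
  have hB (t : ℝ) (ht : t ∈ Set.Ioo (0 : ℝ) 1) : W (γ t) * B = 0 := by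
    have := mul_weight_eq hγ hW (x := 0) (Commute.zero_left _) (Commute.zero_left _)
      (Commute.zero_left _) ht₀ (y := B)
      (by rw [zero_mul, Matrix.mul_vecMulVec, hMv, Matrix.zero_vecMulVec]) ht
    rw [← this, zero_mul]
  have h0 : moment γ W 0 * B = 0 := by
    rw [moment, ← contourInt_mul_const (contourIntegrable_pow_smul hγ hJ 0),
      contourInt_congr (G := fun _ => 0) fun t ht => by rw [smul_mul_assoc, hB t ht, smul_zero]]
    ext i j
    simp [contourInt]
  have hB0 : B = 0 := (hdet.mul_right_eq_zero).1 h0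
  obtain ⟨i, hi⟩ := Function.ne_iff.1 hv
  have := congrFun (congrFun hB0 i) i
  simp only [B, Matrix.vecMulVec_apply, Matrix.zero_apply, mul_self_eq_zero] at this
  exact hi this

/-- A matrix commuting with the coefficients of the Pearson equation intertwines all moments
with one and the same matrix. -/
theorem exists_intertwiner (hJ : IsJacobiType γ W) (hdet : IsUnit (moment γ W 0)) {x : Mat N}
    (h0 : Commute x h₀) (h1 : Commute x h₁) (h2 : Commute x h₂) :
    ∃ y : Mat N, ∀ n, x * moment γ W n = moment γ W n * y := by
  have ht₀ : (1 / 2 : ℝ) ∈ Set.Ioo (0 : ℝ) 1 := by norm_num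
  obtain ⟨M, hM⟩ := isUnit_weight hγ hW hJ hdet ht₀
  refine ⟨↑M⁻¹ * x * M, fun n => ?_⟩
  have hi := contourIntegrable_pow_smul hγ hJ n
  rw [moment, ← contourInt_const_mul hi, ← contourInt_mul_const hi]
  refine contourInt_congr fun t ht => ?_
  rw [mul_smul_comm, smul_mul_assoc,
    mul_weight_eq hγ hW h0 h1 h2 ht₀ (y := ↑M⁻¹ * x * M) ?_ ht]
  rw [← hM, ← mul_assoc, ← mul_assoc, Units.mul_inv, one_mul]

end Intertwining

/-! ### The non-Abelian system and its reduction -/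

section Transfer

variable {N : ℕ} {γ : ℝ → ℂ} {W : ℂ → Mat N} {P : ℕ → (Mat N)[X]} {C β : ℕ → Mat N}

theorem IsLeftOrthogonal.isOrthogonalSystem (hγ : IsSupportCurve γ) (hJ : IsJacobiType γ W)
    (h : IsLeftOrthogonal γ W P C) :
    IsOrthogonalSystem (moment γ W) P C (fun n => (C n)⁻¹) (gammaL C) where
  coeff_gt n i hi := coeff_eq_zero_of_natDegree_lt ((h n).1.trans_lt hi)
  coeff_self n := (h n).2.1
  mul_norm n := Matrix.mul_nonsing_inv _ ((Matrix.isUnit_iff_isUnit_det _).1 (h n).2.2.1)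
  norm_mul n := Matrix.nonsing_inv_mul _ ((Matrix.isUnit_iff_isUnit_det _).1 (h n).2.2.1)
  pairing_lt n k hk := by
    rw [← contourInt_eval_mul hγ hJ, (h n).2.2.2 k hk.le, if_neg hk.ne]
  pairing_self n := by
    rw [← contourInt_eval_mul hγ hJ, (h n).2.2.2 n le_rfl, if_pos rfl]
  gamma_zero := rfl
  gamma_succ _ := rfl

theorem existsUnique_isLeftOrthogonal (hγ : IsSupportCurve γ) (hJ : IsJacobiType γ W)
    (hreg : IsRegularWeight γ W) :
    ∃! PC : (ℕ → (Mat N)[X]) × (ℕ → Mat N), IsLeftOrthogonal γ W PC.1 PC.2 := by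
  choose P hgt hlead hlt hunit using exists_monic_orthogonal (m := moment γ W) hreg
  have hdet (n : ℕ) := (Matrix.isUnit_iff_isUnit_det _).1 (hunit n)
  have hP : IsLeftOrthogonal γ W P fun n => (momentPairing (moment γ W) n (P n))⁻¹ := fun n => by
    refine ⟨natDegree_le_iff_coeff_eq_zero.2 (hgt n), hlead n,
      Matrix.isUnit_nonsing_inv_iff.2 (hunit n), fun k hk => ?_⟩
    rw [contourInt_eval_mul hγ hJ]
    split_ifs with hkn
    · rw [Matrix.nonsing_inv_nonsing_inv _ (hdet n), hkn]
    · exact hlt n k (lt_of_le_of_ne hk hkn)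
  refine ⟨(P, _), hP, fun ⟨P', C'⟩ h' => ?_⟩
  have s := hP.isOrthogonalSystem hγ hJ
  have s' := IsLeftOrthogonal.isOrthogonalSystem hγ hJ h'
  have e : P' = P := by
    funext n
    refine sub_eq_zero.1 (s.eq_zero n _ (fun i hi => ?_) fun k hk => ?_)
    · rw [coeff_sub]
      rcases hi.eq_or_lt with rfl | hi
      · rw [s.coeff_self, s'.coeff_self, sub_self]
      · rw [s.coeff_gt n i hi, s'.coeff_gt n i hi, sub_self]
    · rw [map_sub, s.pairing_lt n k hk, s'.pairing_lt n k hk, sub_self]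
  refine Prod.ext e (funext fun n => ?_)
  have hC := s'.pairing_self n
  simp only at hC ⊢
  rw [← e, hC,
    Matrix.nonsing_inv_nonsing_inv _ ((Matrix.isUnit_iff_isUnit_det _).1 (h' n).2.2.1)]

theorem threeTerm_iff : ThreeTerm P C β ↔
    ∀ n, mulX (P n) = P (n + 1) + β n • P n + gammaL C n • P (n - 1) := by
  simp only [ThreeTerm, mulX_apply, smul_eq_C_mul]

theorem existsUnique_threeTerm {m : ℕ → Mat N} {E : ℕ → Mat N}
    (h : IsOrthogonalSystem m P C E (gammaL C)) : ∃! β : ℕ → Mat N, ThreeTerm P C β :=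
  ⟨_, threeTerm_iff.2 h.three_term, fun _ hβ => funext (h.beta_eq (threeTerm_iff.1 hβ))⟩

theorem two_mul_add_intCast_smul_one (n : ℕ) (k : ℤ) :
    (2 * (n : ℂ) + k) • (1 : Mat N) = 2 * (n : Mat N) + k := by
  rw [← Algebra.algebraMap_eq_smul_one]
  simp [map_ofNat (algebraMap ℂ (Mat N)) 2]

variable {h₀ h₁ h₂ : Mat N}

theorem nonAbelianSystem {m : ℕ → Mat N}
    (h : IsOrthogonalSystem m P C (fun n => (C n)⁻¹) (gammaL C)) (hβ : ThreeTerm P C β)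
    (hm : ∀ j : ℕ, ((j : Mat N) + 1) * m j - ((j : Mat N) + 2) * m (j + 1)
      + (h₀ * m j + h₁ * m (j + 1) + h₂ * m (j + 2)) = 0) (n : ℕ) :
    NonAbelianEq1 h₀ h₁ h₂ C β n ∧ NonAbelianEq2 h₁ h₂ C β n := by
  have s1 := two_mul_add_intCast_smul_one (N := N) n 1
  have s3 := two_mul_add_intCast_smul_one (N := N) n 3
  have s1' := two_mul_add_intCast_smul_one (N := N) n (-1)
  push_cast at s1 s3 s1'
  rw [← sub_eq_add_neg, ← sub_eq_add_neg] at s1'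
  have e1 := h.first_equation (threeTerm_iff.1 hβ) hm n
  have e2 := h.second_equation (threeTerm_iff.1 hβ) hm n
  rw [← s1] at e1
  rw [← s3, ← s1'] at e2
  exact ⟨e1, e2⟩

end Transfer

section Reduction

variable {N : ℕ} {C β : ℕ → Mat N} {h₀ h₁ h₂ : Mat N}

/-- The algebra generated by the coefficients of the Pearson equation and of the three term
recurrence. -/
def coefficientAlgebra (h₀ h₁ h₂ : Mat N) (C β : ℕ → Mat N) : Subalgebra ℂ (Mat N) :=
  Algebra.adjoin ℂ (({h₀, h₁, h₂} : Set (Mat N)) ∪ Set.range β ∪ Set.range (gammaL C))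

theorem h₀_mem : h₀ ∈ coefficientAlgebra h₀ h₁ h₂ C β := Algebra.subset_adjoin (by simp)

theorem h₁_mem : h₁ ∈ coefficientAlgebra h₀ h₁ h₂ C β := Algebra.subset_adjoin (by simp)

theorem h₂_mem : h₂ ∈ coefficientAlgebra h₀ h₁ h₂ C β := Algebra.subset_adjoin (by simp)

theorem beta_mem (n : ℕ) : β n ∈ coefficientAlgebra h₀ h₁ h₂ C β :=
  Algebra.subset_adjoin (by simp)

theorem gammaL_mem (n : ℕ) : gammaL C n ∈ coefficientAlgebra h₀ h₁ h₂ C β :=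
  Algebra.subset_adjoin (by simp)

theorem betaSum_mem (n : ℕ) : betaSum β n ∈ coefficientAlgebra h₀ h₁ h₂ C β :=
  sum_mem fun k _ => beta_mem k

theorem pairSum_mem (n : ℕ) : pairSum C β n ∈ coefficientAlgebra h₀ h₁ h₂ C β :=
  sub_mem (sum_mem fun i _ => sum_mem fun j _ => mul_mem (beta_mem i) (beta_mem j))
    (sum_mem fun k _ => gammaL_mem k)

theorem xi_mem (n : ℕ) : xi h₀ h₂ C β n ∈ coefficientAlgebra h₀ h₁ h₂ C β :=
  sub_mem (add_mem (add_mem (Subalgebra.smul_mem _ h₀_mem _)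
    (Subalgebra.smul_mem _ (one_mem _) _)) (mul_mem h₂_mem (gammaL_mem n))) (betaSum_mem n)

theorem mu_mem (n : ℕ) : mu h₁ h₂ β n ∈ coefficientAlgebra h₀ h₁ h₂ C β :=
  sub_mem (add_mem (mul_mem h₂_mem (beta_mem n)) h₁_mem) (Subalgebra.smul_mem _ (one_mem _) _)

theorem AllCommute.commute (hc : AllCommute h₀ h₁ h₂ C β) {x y : Mat N}
    (hx : x ∈ coefficientAlgebra h₀ h₁ h₂ C β) (hy : y ∈ coefficientAlgebra h₀ h₁ h₂ C β) :
    Commute x y := by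
  have h := Algebra.adjoin_le_centralizer_centralizer ℂ
    (({h₀, h₁, h₂} : Set (Mat N)) ∪ Set.range β ∪ Set.range (gammaL C))
  refine Set.centralizer_centralizer_comm_of_comm (fun a ha b hb => ?_) _ (h hx) _ (h hy)
  rcases eq_or_ne a b with rfl | hab
  exacts [rfl, hc ha hb hab]

theorem betaSum_succ (n : ℕ) : betaSum β (n + 1) = betaSum β n + β n := Finset.sum_range_succ _ _

/-- The reduction of the non-Abelian system when all matrices commute and the conjugations by
the `C n` act trivially. -/
theorem abelianSystem_of_allCommute
    (hc : AllCommute h₀ h₁ h₂ C β) (hu : ∀ n, IsUnit (C n))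
    (hconj : ∀ n k, (C n)⁻¹ * betaR C β k * C n = β k) (n : ℕ)
    (e1 : NonAbelianEq1 h₀ h₁ h₂ C β n) (e2 : NonAbelianEq2 h₁ h₂ C β n) :
    AbelianSystem h₀ h₁ h₂ C β n := by
  have hsum (l : ℕ) : (C n)⁻¹ * betaSum (betaR C β) l * C n = betaSum β l := by
    simp only [betaSum, Finset.mul_sum, Finset.sum_mul, hconj]
  have hCC : C n * (C n)⁻¹ = 1 :=
    Matrix.mul_nonsing_inv _ ((Matrix.isUnit_iff_isUnit_det _).1 (hu n))
  have hlie : (C n)⁻¹ * ⁅betaSum (betaR C β) n, betaSum (betaR C β) (n + 1)⁆ * C n = 0 := by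
    have hmul (A B : Mat N) :
        (C n)⁻¹ * (A * B) * C n = ((C n)⁻¹ * A * C n) * ((C n)⁻¹ * B * C n) := by
      simp only [mul_assoc]
      rw [← mul_assoc (C n), hCC, one_mul]
    rw [Ring.lie_def, mul_sub, sub_mul, hmul, hmul, hsum, hsum, sub_eq_zero]
    exact hc.commute (betaSum_mem n) (betaSum_mem (n + 1))
  rw [NonAbelianEq1, hsum, (hc.commute (betaSum_mem n) h₂_mem).lie_eq,
    (hc.commute (pairSum_mem n) h₂_mem).lie_eq, (hc.commute (betaSum_mem n) h₁_mem).lie_eq,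
    zero_mul, sub_zero, add_zero] at e1
  rw [NonAbelianEq2, hlie, (hc.commute (betaSum_mem n) h₂_mem).lie_eq,
    (hc.commute (betaSum_mem (n - 1)) h₂_mem).lie_eq, zero_mul, mul_zero, neg_zero, sub_zero,
    add_zero] at e2
  have hmu : gammaL C n * mu h₁ h₂ β (n - 1) =
      gammaL C n * (h₂ * β (n - 1) + h₁ - (2 * (n : ℂ) - 1) • (1 : Mat N)) := by
    cases n with
    | zero => simp [gammaL]
    | succ n =>
      rw [mu, Nat.add_sub_cancel]
      congr 4
      push_cast
      ring
  refine ⟨e1, e2, ?_, ?_⟩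
  · rw [neg_eq_iff_add_eq_zero, ← e1]
    simp only [mu, xi, Nat.cast_succ, add_smul, one_smul, mul_smul, two_smul, one_div]
    have : h₀ = (2⁻¹ : ℂ) • h₀ + (2⁻¹ : ℂ) • h₀ := by rw [← add_smul]; norm_num
    nth_rewrite 3 [this]
    noncomm_ring
  · have c1 : β n * (h₂ * gammaL C n) = gammaL C n * (h₂ * β n) := by
      rw [(hc.commute (beta_mem n) (mul_mem h₂_mem (gammaL_mem n))).eq,
        (hc.commute h₂_mem (gammaL_mem n)).eq, mul_assoc]
    have c2 : β n * (h₂ * gammaL C (n + 1)) = h₂ * β n * gammaL C (n + 1) := by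
      rw [← mul_assoc, (hc.commute (beta_mem n) h₂_mem).eq]
    have c3 : mu h₁ h₂ β (n + 1) = h₂ * β (n + 1) + h₁ - (2 * (n : ℂ) + 3) • (1 : Mat N) := by
      rw [mu]
      congr 2
      push_cast
      ring
    have hxi : xi h₀ h₂ C β n - xi h₀ h₂ C β (n + 1) =
        h₂ * gammaL C n - h₂ * gammaL C (n + 1) + β n - 1 := by
      simp only [xi, betaSum_succ, Nat.cast_succ, add_smul, one_smul]
      noncomm_ring
    rw [hmu, c3, hxi, ← sub_eq_zero, ← neg_eq_zero, ← e2, mul_sub, mul_add, mul_sub, c1, c2]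
    noncomm_ring

/-- Multiplying the two equations of the local system shows that
`ξ_n ^ 2 - γ_n μ_{n-1} μ_n` does not depend on `n`; at `n = 0` it is `ξ_0 ^ 2` since `γ_0 = 0`. -/
theorem discretePIV_of_abelianSystem (hc : AllCommute h₀ h₁ h₂ C β)
    (h : ∀ n, AbelianSystem h₀ h₁ h₂ C β n) (n : ℕ) : DiscretePIV h₀ h₁ h₂ C β n := by
  have hβμ (n : ℕ) : β n * mu h₁ h₂ β n = -(xi h₀ h₂ C β n + xi h₀ h₂ C β (n + 1)) := by
    rw [← (h n).2.2.1, neg_neg, (hc.commute (beta_mem n) (mu_mem n)).eq]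
  refine ⟨?_, hβμ n⟩
  -- the difference of consecutive squares telescopes
  have step (n : ℕ) : xi h₀ h₂ C β (n + 1) ^ 2 - xi h₀ h₂ C β n ^ 2 =
      gammaL C (n + 1) * mu h₁ h₂ β n * mu h₁ h₂ β (n + 1)
        - gammaL C n * mu h₁ h₂ β (n - 1) * mu h₁ h₂ β n := by
    have e3 := (h n).2.2.1
    have e4 := (h n).2.2.2
    have cx := (hc.commute (xi_mem n) (xi_mem (n + 1))).eq
    have c1 := (hc.commute (mu_mem n) (mul_mem (mu_mem (n + 1)) (gammaL_mem (n + 1)))).eq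
    have c2 := (hc.commute (mu_mem n) (mul_mem (gammaL_mem n) (mu_mem (n - 1)))).eq
    have c4 := (hc.commute (mu_mem (n + 1)) (mul_mem (gammaL_mem (n + 1)) (mu_mem n))).eq
    calc xi h₀ h₂ C β (n + 1) ^ 2 - xi h₀ h₂ C β n ^ 2
        = -((xi h₀ h₂ C β n + xi h₀ h₂ C β (n + 1))
          * (xi h₀ h₂ C β n - xi h₀ h₂ C β (n + 1))) := by
          rw [add_mul, mul_sub, mul_sub, cx]; noncomm_ring
      _ = mu h₁ h₂ β n * (β n * (xi h₀ h₂ C β n - xi h₀ h₂ C β (n + 1))) := by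
          rw [← e3]; noncomm_ring
      _ = _ := by rw [e4, mul_sub, c1, c2, mul_assoc (mu h₁ h₂ β (n + 1)), c4]
  induction n with
  | zero => rw [step 0]; simp [gammaL]
  | succ n ih => rw [← sub_add_sub_cancel, step (n + 1), ih, Nat.add_sub_cancel, sub_add_cancel]

theorem discretePIVInv_of_discretePIV (hc : AllCommute h₀ h₁ h₂ C β) (hu : ∀ n, IsUnit (C n))
    {n : ℕ} (h : DiscretePIV h₀ h₁ h₂ C β n) (hh : IsUnit h₂) (hμ : IsUnit (mu h₁ h₂ β n))
    (hμ' : IsUnit (mu h₁ h₂ β (n + 1))) : DiscretePIVInv h₀ h₁ h₂ C β n := by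
  have hg : IsUnit (gammaL C (n + 1)) := (Matrix.isUnit_nonsing_inv_iff.2 (hu (n + 1))).mul (hu n)
  have hinv : h₂⁻¹ * h₂ = 1 :=
    Matrix.nonsing_inv_mul _ ((Matrix.isUnit_iff_isUnit_det _).1 hh)
  refine ⟨?_, ?_, ?_⟩
  · rw [h.1]
    exact (hg.mul hμ).mul hμ'
  · have hxi : xi h₀ h₂ C β (n + 1) - (1 / 2 : ℂ) • h₀ - ((n : ℂ) + 1) • (1 : Mat N)
        + betaSum β (n + 1) = h₂ * gammaL C (n + 1) := by
      rw [xi, Nat.cast_succ]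
      abel
    have hcomm : gammaL C (n + 1) * mu h₁ h₂ β n * mu h₁ h₂ β (n + 1) =
        mu h₁ h₂ β (n + 1) * mu h₁ h₂ β n * gammaL C (n + 1) := by
      rw [mul_assoc, (hc.commute (gammaL_mem (n + 1)) (mul_mem (mu_mem n) (mu_mem (n + 1)))).eq,
        (hc.commute (mu_mem n) (mu_mem (n + 1))).eq]
    rw [hxi, h.1, hcomm, ← mul_assoc h₂⁻¹, hinv, one_mul, Matrix.mul_inv_rev, Matrix.mul_inv_rev,
      ← mul_assoc, Matrix.mul_nonsing_inv _ ((Matrix.isUnit_iff_isUnit_det _).1 hg), one_mul]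
  · rw [Matrix.nonsing_inv_nonsing_inv _ ((Matrix.isUnit_iff_isUnit_det _).1 hμ)]
    have e : h₂⁻¹ * h₁ - h₂⁻¹ * mu h₁ h₂ β n - (2 * (n : ℂ) + 1) • h₂⁻¹ =
        -(h₂⁻¹ * h₂ * β n) := by
      rw [mu, mul_sub, mul_add, mul_smul_comm, mul_one, ← mul_assoc]
      abel
    rw [e, hinv, one_mul, neg_mul, h.2, neg_neg]

end Reduction

end

theorem mainTheorem1 (N : ℕ) (γ : ℝ → ℂ) (hγ : IsSupportCurve γ)
    (W : ℂ → Mat N) (hJ : IsJacobiType γ W) (hreg : IsRegularWeight γ W)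
    (h₀ h₁ h₂ : Mat N) (hW : SatisfiesPearson γ W h₀ h₁ h₂) :
    (∃! PC : (ℕ → Polynomial (Mat N)) × (ℕ → Mat N), IsLeftOrthogonal γ W PC.1 PC.2) ∧
    ∀ (P : ℕ → Polynomial (Mat N)) (C : ℕ → Mat N), IsLeftOrthogonal γ W P C →
      (∃! β : ℕ → Mat N, ThreeTerm P C β) ∧
      ∀ β : ℕ → Mat N, ThreeTerm P C β →
        (∀ n : ℕ, NonAbelianEq1 h₀ h₁ h₂ C β n ∧ NonAbelianEq2 h₁ h₂ C β n) ∧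
        (Commute h₀ h₁ → Commute h₀ h₂ → Commute h₁ h₂ →
          AllCommute h₀ h₁ h₂ C β ∧
          ∀ n : ℕ, AbelianSystem h₀ h₁ h₂ C β n ∧ DiscretePIV h₀ h₁ h₂ C β n ∧
            (IsUnit h₂ → IsUnit (mu h₁ h₂ β n) → IsUnit (mu h₁ h₂ β (n + 1)) →
              DiscretePIVInv h₀ h₁ h₂ C β n)) := by
  refine ⟨existsUnique_isLeftOrthogonal hγ hJ hreg, fun P C hP => ?_⟩
  have s := hP.isOrthogonalSystem hγ hJ
  refine ⟨existsUnique_threeTerm s, fun β hβ => ?_⟩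
  have hNA := nonAbelianSystem s hβ (moment_recurrence hγ hJ hW)
  refine ⟨hNA, fun h01 h02 h12 => ?_⟩
  have hm0 : IsUnit (moment γ W 0) := by
    have e : momentPairing (moment γ W) 0 (P 0) = moment γ W 0 := by
      have : P 0 = monomial 0 1 := by
        ext i : 1
        cases i with
        | zero => simp [s.coeff_self]
        | succ i => rw [s.coeff_gt 0 _ i.succ_pos, coeff_monomial, if_neg (by omega)]
      rw [this, momentPairing_monomial, one_mul]
    rw [← e, s.pairing_self]
    exact Matrix.isUnit_nonsing_inv_iff.2 (hP 0).2.2.1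
  have key {x : Mat N} (h0 : Commute x h₀) (h1 : Commute x h₁) (h2 : Commute x h₂) (n : ℕ) :
      Commute x (β n) ∧ Commute x (gammaL C n) ∧ ∀ k, (C n)⁻¹ * (C k * x * (C k)⁻¹) * C n = x := by
    obtain ⟨y, hy⟩ := exists_intertwiner hγ hW hJ hm0 h0 h1 h2
    exact ⟨s.commute_beta hy (threeTerm_iff.1 hβ) n, s.commute_gamma hy n, s.conj_conj_eq hy n⟩
  have k0 := key (Commute.refl h₀) h01 h02
  have k1 := key h01.symm (Commute.refl h₁) h12
  have k2 := key h02.symm h12.symm (Commute.refl h₂)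
  have hS : ∀ x ∈ ({h₀, h₁, h₂} : Set (Mat N)) ∪ Set.range β ∪ Set.range (gammaL C),
      Commute x h₀ ∧ Commute x h₁ ∧ Commute x h₂ := by
    rintro x (((rfl | rfl | rfl) | ⟨n, rfl⟩) | ⟨n, rfl⟩)
    · exact ⟨Commute.refl _, h01, h02⟩
    · exact ⟨h01.symm, Commute.refl _, h12⟩
    · exact ⟨h02.symm, h12.symm, Commute.refl _⟩
    · exact ⟨(k0 n).1.symm, (k1 n).1.symm, (k2 n).1.symm⟩
    · exact ⟨(k0 n).2.1.symm, (k1 n).2.1.symm, (k2 n).2.1.symm⟩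
  have hall : AllCommute h₀ h₁ h₂ C β := by
    intro x hx z hz _
    obtain ⟨x0, x1, x2⟩ := hS x hx
    rcases hz with ((rfl | rfl | rfl) | ⟨n, rfl⟩) | ⟨n, rfl⟩
    exacts [x0, x1, x2, (key x0 x1 x2 n).1, (key x0 x1 x2 n).2.1]
  have hu (n : ℕ) : IsUnit (C n) := (hP n).2.2.1
  have hab (n : ℕ) : AbelianSystem h₀ h₁ h₂ C β n :=
    abelianSystem_of_allCommute hall hu (fun n k =>
      (key (k0 k).1.symm (k1 k).1.symm (k2 k).1.symm n).2.2 k) n (hNA n).1 (hNA n).2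
  refine ⟨hall, fun n => ?_⟩
  have hd := discretePIV_of_abelianSystem hall hab n
  exact ⟨hab n, hd, discretePIVInv_of_discretePIV hall hu hd⟩
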